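/- **Setting.** A full-dimensional convex body in $\mathbb{R}^n$ is a compact convex set with nonempty interior; a full-dimensional polytope is a convex hull of a finite set with nonempty interior. A family $(K_t)_{t\in[0,1]}$ of full-dimensional convex bodies is *weakly differentiable* with *weak derivative* $K_0'$ if for every continuous $g\colon\mathbb{R}^n\to\mathbb{R}$ the function $t\mapsto\int_{K_t} g(x)\,\mathrm{d}x$ has a derivative from the right at $t=0$, equal to $K_0'(g)$. A finite signed Borel measure $\mu$ on $\partial K$ (identified with its trivial extension to $\mathbb{R}^n$) is a *small perturbation* of $K$ if there is a weakly differentiable family with $K_0=K$ and $K_0'(g)=\int_{\partial K} g\,\mathrm{d}\mu$ for all continuous $g$; we then say that the family realizes $\mu$. A function on a convex set $K$ is *piecewise affine concave* if it is the pointwise minimum $\min_{h\in\mathcal{H}}h$ of a nonempty finite family $\mathcal H$ of affine functionals on $\operatorname{aff}K$; its *canonical extension* to $\operatorname{aff}K$ is the minimum over $\operatorname{aff}K$ of the unique family $\mathcal H$ that is irredundant, i.e. in which each $h$ is strictly smaller than all other members at some point of $K$. For a Borel set $A$ and $f$ integrable on $A$, $[f]_A$ denotes the signed measure on $A$ with density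 $f$ with respect to the volume of dimension $\dim\operatorname{aff}A$. **Proposition 3.2.** Let $P\subset\mathbb{R}^n$ be a full-dimensional polytope and let $f\colon\partial P\to\mathbb{R}$ be a measurable function such that for each facet $F$ of $P$ the restriction $f|_{\operatorname{relint}F}$ is piecewise affine concave. Then $P$ has finitely many facets, $f$ is integrable on each of them with respect to the $(n-1)$-dimensional volume, and $$\mu_f:=\sum_{F\text{ facet of }P}[f|_F]_F$$ is a small perturbation of $P$. Moreover, it is realized by the following families of polytopes. Let $P=\{x\mid\langle u_i,x\rangle\le b_i,\ i=1,\dots,m\}$ be an irredundant description with unit vectors $u_i$, let $F_i=P\cap\{x \mid \langle u_i,x\rangle=b_i\}$, and let $v$ be a unit vector with $\langle u_i,v\rangle\ne0$ for all $i$. Let $\pi$ be the orthogonal projection onto $v^\perp$ and, for $x\in\mathbb{R}^n$, put $$h_i(x)=\frac{b_i-\langle u_i,\pi(x)\rangle}{\langle u_i,v\rangle},\qquad f_i(x)=\frac{\overline{f|_{\operatorname{relint}F_i}}\bigl(\pi(x)+h_i(x)v\bigr)}{|\langle u_i,v\rangle|},$$ where $\overline{f|_{\operatorname{relint}F_i}}$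 is the canonical extension to $\operatorname{aff}F_i$. For $t\in[0,1]$ let $\tilde P_t$ be the set of all $x\in\mathbb{R}^n$ with $\pi(x)\in\pi(P)$, with $\langle v,x\rangle\le h_i(x)+tf_i(x)$ for all $i$ with $\langle u_i,v\rangle>0$, and with $\langle v,x\rangle\ge h_i(x)-tf_i(x)$ for all $i$ with $\langle u_i,v\rangle<0$. Put $P_t=\tilde P_t$ if $\tilde P_t$ is full-dimensional and $P_t=P$ otherwise. Then every $P_t$ is a full-dimensional polytope, $P_0=P$, and $(P_t)_{t\in[0,1]}$ is weakly differentiable with $P_0'(g)=\int_{\partial P}g\,\mathrm{d}\mu_f$ for all continuous $g\colon\mathbb{R}^n\to\mathbb{R}$. -/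

import Mathlib

open MeasureTheory Set
open scoped Topology

noncomputable section

namespace SmallPerturbation

/-- The Euclidean space `ℝⁿ` with the standard scalar product. -/
abbrev Euc (n : ℕ) : Type := EuclideanSpace ℝ (Fin n)

section ConvexBodies

variable {n : ℕ}

/-- Full-dimensional convex bodies of `ℝⁿ`: compact convex sets with nonempty interior. -/
def IsFullConvexBody (K : Set (Euc n)) : Prop :=
  Convex ℝ K ∧ IsCompact K ∧ (interior K).Nonempty

/-- Full-dimensional polytopes of `ℝⁿ`: convex hulls of finite sets, with nonempty interior. -/
def IsFullPolytope (P : Set (Euc n)) : Prop :=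
  (∃ V : Set (Euc n), V.Finite ∧ P = convexHull ℝ V) ∧ (interior P).Nonempty

/-- The family `(K t)`, of which only the members with `t ∈ [0,1]` matter, consists of
full-dimensional convex bodies and is weakly differentiable (at `t = 0`, from the right), with weak
derivative `L`: for every continuous `g : ℝⁿ → ℝ`, the one-sided derivative of `t ↦ ∫_{K t} g` at
`t = 0` exists and equals `L g`. -/
def HasWeakDerivative (K : ℝ → Set (Euc n)) (L : (Euc n → ℝ) → ℝ) : Prop :=
  (∀ t ∈ Icc (0 : ℝ) 1, IsFullConvexBody (K t)) ∧
    ∀ g : Euc n → ℝ, Continuous g →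
      HasDerivWithinAt (fun t : ℝ => ∫ x in K t, g x) (L g) (Icc 0 1) 0

/-- The signed measure `μ` is supported on `A`. Finite signed Borel measures on `A` are identified
with the signed measures on `ℝⁿ` supported on `A` (trivial extension). -/
def IsSupportedOn (μ : SignedMeasure (Euc n)) (A : Set (Euc n)) : Prop :=
  ∀ B : Set (Euc n), MeasurableSet B → Disjoint B A → μ B = 0

/-- The family `K` is weakly differentiable, starts at `K₀`, and its weak derivative is represented
by the signed measure `μ` on the boundary of `K₀`. -/
def Realizes (K : ℝ → Set (Euc n)) (K₀ : Set (Euc n)) (μ : SignedMeasure (Euc n)) : Prop :=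
  K 0 = K₀ ∧ IsSupportedOn μ (frontier K₀) ∧
    HasWeakDerivative K (fun g => ∫ᵛ x in frontier K₀, g x ∂•μ)

/-- The set of small perturbations of `K₀`. -/
def smallPerturbations (K₀ : Set (Euc n)) : Set (SignedMeasure (Euc n)) :=
  {μ | ∃ K : ℝ → Set (Euc n), Realizes K K₀ μ}

end ConvexBodies

section Facets

variable {n : ℕ}

/-- The dimension of (the affine hull of) a nonempty set. -/
def affDim (A : Set (Euc n)) : ℕ := Module.finrank ℝ (vectorSpan ℝ A)

/-- The facets of `P`: nonempty faces (maximizing sets over `P` of a linear functional) of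
dimension `n - 1`. -/
def facets (P : Set (Euc n)) : Set (Set (Euc n)) :=
  {F | F.Nonempty ∧ IsExposed ℝ P F ∧ affDim F + 1 = n}

/-- The volume on `A` of dimension `dim (aff A)`, as a measure on `ℝⁿ`. -/
def relVolume (A : Set (Euc n)) : Measure (Euc n) :=
  (Measure.euclideanHausdorffMeasure (affDim A)).restrict A

/-- The signed measure on `A` with density `f` with respect to the volume of dimension
`dim (aff A)`, trivially extended to `ℝⁿ`. -/
def densityMeasure (A : Set (Euc n)) (f : Euc n → ℝ) : SignedMeasure (Euc n) :=
  (relVolume A).withDensityᵥ f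

/-- The sum over all facets `F` of `P` of the signed measures on `F` with density `f|_F`. -/
def facetMeasure (P : Set (Euc n)) (f : Euc n → ℝ) : SignedMeasure (Euc n) :=
  ∑ᶠ F ∈ facets P, densityMeasure F f

end Facets

section PiecewiseAffine

variable {n : ℕ}

/-- The pointwise minimum of a nonempty finite family of affine functionals. -/
def minOf (H : Finset (Euc n →ᵃ[ℝ] ℝ)) (hH : H.Nonempty) (x : Euc n) : ℝ :=
  H.inf' hH (fun h => h x)

/-- `f` is on `K` the minimum of finitely many affine functionals, i.e., a piecewise affine concave
function. (Affine functionals on `aff K` are the restrictions of affine functionals on `ℝⁿ`.) -/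
def IsPiecewiseAffineConcaveOn (K : Set (Euc n)) (f : Euc n → ℝ) : Prop :=
  ∃ (H : Finset (Euc n →ᵃ[ℝ] ℝ)) (hH : H.Nonempty), ∀ x ∈ K, f x = minOf H hH x

/-- The family `H` is an irredundant description of `f` on `K`: `f = min H` on `K`, and every member
of `H` is somewhere on `K` strictly smaller than all others. -/
def IsIrredundantFamily (K : Set (Euc n)) (f : Euc n → ℝ) (H : Finset (Euc n →ᵃ[ℝ] ℝ)) : Prop :=
  (∃ hH : H.Nonempty, ∀ x ∈ K, f x = minOf H hH x) ∧
    ∀ h ∈ H, ∃ x ∈ K, ∀ g ∈ H, g ≠ h → h x < g x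

open Classical in
/-- The canonical extension of a piecewise affine concave function `f` on `K` to `aff K`: the
minimum of an irredundant family describing `f`. The restrictions to `aff K` of the members of such
a family are unique, so the values on `aff K`, which are the only ones used, do not depend on the
choice. -/
def canonicalExtension (K : Set (Euc n)) (f : Euc n → ℝ) : Euc n → ℝ :=
  if h : ∃ H, IsIrredundantFamily K f H then minOf h.choose h.choose_spec.1.choose else 0

end PiecewiseAffine

section Family

variable {n m : ℕ}

/-- The unit vectors `u i` and numbers `b i` form an irredundant description of `P` by linear
inequalities. -/
def IsIrredundantDescription (P : Set (Euc n)) (u : Fin m → Euc n) (b : Fin m → ℝ) : Prop :=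
  (∀ i, ‖u i‖ = 1) ∧ P = {x | ∀ i, inner ℝ (u i) x ≤ b i} ∧
    ∀ i, {x | ∀ j, j ≠ i → inner ℝ (u j) x ≤ b j} ≠ P

/-- `v` is a unit vector not parallel to any of the hyperplanes with normals `u i`. -/
def IsGeneric (u : Fin m → Euc n) (v : Euc n) : Prop :=
  ‖v‖ = 1 ∧ ∀ i, inner ℝ (u i) v ≠ 0

/-- The orthogonal projection onto the hyperplane `v^⊥`. -/
def proj (v : Euc n) (x : Euc n) : Euc n := (ℝ ∙ v)ᗮ.starProjection x

/-- The facet of `P` in the hyperplane `⟨w, x⟩ = c`. -/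
def facetOf (P : Set (Euc n)) (w : Euc n) (c : ℝ) : Set (Euc n) :=
  {x ∈ P | inner ℝ w x = c}

/-- The height over `v^⊥` in direction `v` of the hyperplane `⟨w, x⟩ = c`. -/
def height (v w : Euc n) (c : ℝ) (x : Euc n) : ℝ :=
  (-inner ℝ w (proj v x) + c) / inner ℝ w v

/-- The point of the hyperplane `⟨w, x⟩ = c` over the point `x` of `v^⊥`, i.e., the inverse of the
restriction of `proj v` to this hyperplane. -/
def lift (v w : Euc n) (c : ℝ) (x : Euc n) : Euc n := x + height v w c x • v

/-- The velocity in direction `v`, over a point `x` of `v^⊥`, of the hypersurface that carries the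
facet of `P` in `⟨w, x⟩ = c`. -/
def velocity (P : Set (Euc n)) (f : Euc n → ℝ) (v w : Euc n) (c : ℝ) (x : Euc n) : ℝ :=
  canonicalExtension (intrinsicInterior ℝ (facetOf P w c)) f (lift v w c x) / |inner ℝ w v|

/-- The points of the cylinder over the projection of `P` to `v^⊥` whose height lies below all
upper hypersurfaces (`⟨u i, v⟩ > 0`) and above all lower ones (`⟨u i, v⟩ < 0`) at time `t`. -/
def movedPolytope (P : Set (Euc n)) (f : Euc n → ℝ) (u : Fin m → Euc n) (b : Fin m → ℝ)
    (v : Euc n) (t : ℝ) : Set (Euc n) :=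
  {x | proj v x ∈ proj v '' P ∧
    (∀ i, 0 < inner ℝ (u i) v →
      inner ℝ v x ≤ height v (u i) (b i) x + t * velocity P f v (u i) (b i) (proj v x)) ∧
    (∀ i, inner ℝ (u i) v < 0 →
      height v (u i) (b i) x - t * velocity P f v (u i) (b i) (proj v x) ≤ inner ℝ v x)}

open Classical in
/-- The family of polytopes obtained by moving the hypersurfaces; it is reset to `P` at those times
at which the moved polytope is not full-dimensional. -/
def polytopeFamily (P : Set (Euc n)) (f : Euc n → ℝ) (u : Fin m → Euc n) (b : Fin m → ℝ)
    (v : Euc n) (t : ℝ) : Set (Euc n) :=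
  if (interior (movedPolytope P f u b v t)).Nonempty then movedPolytope P f u b v t else P

end Family

end SmallPerturbation

end

namespace SmallPerturbation

/-! ### Conversion between vertex and half-space descriptions. -/

section Polyhedra

variable {E : Type*} [NormedAddCommGroup E] [InnerProductSpace ℝ E]

/-! Split `ℝⁿ` as `v^⊥ × ℝ`. Over a point `y` of `π(P)` the moved polytope is an interval whose ends
are the minimum of the upper heights `h_i + t f_i` and the maximum of the lower heights `h_i - t
f_i` (`slab`). For almost every `y` the heights `h_i(y)` are pairwise distinct
(`ae_height_injective`), so a single upper and a single lower facet bound the fibre for all small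
`t`. The fundamental theorem of calculus then differentiates the fibre integral of `g`
(`hasDerivAt_integral_slab`). All difference quotients are bounded by one constant on the compact
set `π(P)` (`abs_integral_slab_sub_le`), so dominated convergence permits integration over `y`. The
factor `1 / |⟨u_i, v⟩|` in `f_i` is the Jacobian of the parametrization of the facet over `v^⊥`, so
the result is the sum of the integrals of `g f` over the facets (`integral_indicator_mul_velocity`).

Concavity makes the moved sets polytopes: for `t ≥ 0`, lying below `b_i + t min H` means satisfying
finitely many affine inequalities (`isFullPolytope_movedPolytope`). An interior point of `P` keeps a
neighbourhood in the moved set for small `t`, so resetting the family to `P` does not affect the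
derivative. Dimension zero, where there is no unit vector, has no facets and is treated separately.
-/

theorem isClosed_polyhedron {ι : Type*} (a : ι → E) (b : ι → ℝ) :
    IsClosed {x : E | ∀ i, inner ℝ (a i) x ≤ b i} := by
  simp only [ofPred_forall]
  exact isClosed_iInter fun i => isClosed_le (by fun_prop) continuous_const

theorem convex_polyhedron {ι : Type*} (a : ι → E) (b : ι → ℝ) :
    Convex ℝ {x : E | ∀ i, inner ℝ (a i) x ≤ b i} := by
  simp only [ofPred_forall]
  exact convex_iInter fun i => convex_halfSpace_le (innerₗ E (a i)).isLinear (b i)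

theorem inner_le_of_mem_convexHull {V : Set E} {w : E} {c : ℝ} (h : ∀ x ∈ V, inner ℝ w x ≤ c) :
    ∀ x ∈ convexHull ℝ V, inner ℝ w x ≤ c :=
  fun _ hx => convexHull_min (t := {x | inner ℝ w x ≤ c}) h
    (convex_halfSpace_le (innerₗ E w).isLinear c) hx

/-- A polyhedron has finitely many extreme points. -/
theorem finite_extremePoints_polyhedron {ι : Type*} [Finite ι] (a : ι → E) (b : ι → ℝ) :
    (extremePoints ℝ {x : E | ∀ i, inner ℝ (a i) x ≤ b i}).Finite := by
  -- An extreme point is determined by its active constraints: if `x` and `y` have the same ones,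
  -- the segment from `y` to `x` can be prolonged beyond `x` inside the polyhedron.
  refine Set.Finite.of_injOn (f := fun x => {i | inner ℝ (a i) x = b i}) (t := univ)
    (fun _ _ => mem_univ _) ?_ finite_univ
  intro x hx y hy hxy
  have hact : ∀ i, inner ℝ (a i) x = b i ↔ inner ℝ (a i) y = b i := fun i =>
    Set.ext_iff.1 hxy i
  have hxK := hx.1
  have hyK := hy.1
  have hev : ∀ᶠ t in 𝓝 (0 : ℝ), ∀ i, inner ℝ (a i) x ≠ b i →
      inner ℝ (a i) (x + t • (x - y)) < b i := by
    rw [Filter.eventually_all]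
    intro i
    by_cases h : inner ℝ (a i) x = b i
    · simp [h]
    · have hc : Continuous fun t : ℝ => inner ℝ (a i) (x + t • (x - y)) := by fun_prop
      exact ((hc.tendsto' 0 (inner ℝ (a i) x) (by simp)).eventually_lt_const
        (lt_of_le_of_ne (hxK i) h)).mono fun t ht _ => ht
  obtain ⟨t, ht, ht0⟩ := ((hev.filter_mono nhdsWithin_le_nhds).and
    (self_mem_nhdsWithin (s := Ioi (0 : ℝ)))).exists
  have ht0 : 0 < t := ht0
  have hz : x + t • (x - y) ∈ {x : E | ∀ i, inner ℝ (a i) x ≤ b i} := by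
    intro i
    by_cases h : inner ℝ (a i) x = b i
    · have h' := (hact i).1 h
      simp [inner_add_right, inner_smul_right, inner_sub_right, h, h']
    · exact (ht i h).le
  have hseg : x ∈ openSegment ℝ (x + t • (x - y)) y := by
    refine ⟨1 / (1 + t), t / (1 + t), by positivity, by positivity, by field_simp, ?_⟩
    match_scalars <;> field_simp <;> ring
  have := ((mem_extremePoints.1 hx).2 _ hz _ hyK hseg)
  simp_all

/-- A bounded polyhedron is the convex hull of a finite set. -/
theorem exists_finite_convexHull_eq_polyhedron [FiniteDimensional ℝ E] {ι : Type*} [Finite ι]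
    (a : ι → E) (b : ι → ℝ)
    (hb : Bornology.IsBounded {x : E | ∀ i, inner ℝ (a i) x ≤ b i}) :
    ∃ V : Set E, V.Finite ∧ {x : E | ∀ i, inner ℝ (a i) x ≤ b i} = convexHull ℝ V := by
  refine ⟨_, finite_extremePoints_polyhedron a b, ?_⟩
  have hc := Metric.isCompact_of_isClosed_isBounded (isClosed_polyhedron a b) hb
  have h := closure_convexHull_extremePoints hc (convex_polyhedron a b)
  rw [((finite_extremePoints_polyhedron a b).isCompact_convexHull (𝕜 := ℝ)).isClosed.closure_eq]
    at h
  exact h.symm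

/-- A full-dimensional polytope is a finite intersection of half-spaces. -/
theorem exists_halfSpaces_of_convexHull [FiniteDimensional ℝ E] {V : Set E} (hV : V.Finite)
    {p : E} (hp : p ∈ interior (convexHull ℝ V)) :
    ∃ W : Set E, W.Finite ∧ convexHull ℝ V = {x | ∀ w ∈ W, inner ℝ w (x - p) ≤ 1} := by
  have hpV : p ∈ convexHull ℝ V := interior_subset hp
  have hVf : Finite V := hV
  -- `D` is the polar of `V` about `p`. It is bounded because `p` is interior, hence is itself the
  -- hull of a finite set `W`; by the bipolar argument the points of `W` are the required normals.
  set D : Set E := {y | ∀ w : V, inner ℝ (w - p : E) y ≤ 1} with hD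
  have hDconv : ∀ y ∈ D, ∀ x ∈ convexHull ℝ V, inner ℝ y (x - p) ≤ 1 := by
    intro y hy x hx
    have := inner_le_of_mem_convexHull (w := y) (c := 1 + inner ℝ y p) (V := V) (fun z hz => by
      have := hy ⟨z, hz⟩
      rw [real_inner_comm, inner_sub_right] at this
      simp only at this
      linarith) x hx
    rw [inner_sub_right]; linarith
  have hDb : Bornology.IsBounded D := by
    obtain ⟨r, hr, hball⟩ := Metric.mem_nhds_iff.1 (mem_interior_iff_mem_nhds.1 hp)
    refine isBounded_iff_forall_norm_le.2 ⟨2 / r, fun y hy => ?_⟩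
    by_cases hy0 : y = 0
    · simp [hy0]; positivity
    have hyn : 0 < ‖y‖ := norm_pos_iff.2 hy0
    have hx : p + (r / 2 / ‖y‖) • y ∈ convexHull ℝ V := by
      refine hball ?_
      rw [Metric.mem_ball, dist_eq_norm, add_sub_cancel_left, norm_smul, Real.norm_eq_abs,
        abs_of_pos (by positivity)]
      field_simp
      linarith
    have := hDconv y hy _ hx
    rw [add_sub_cancel_left, inner_smul_right, real_inner_self_eq_norm_sq] at this
    rw [le_div_iff₀ hr]
    field_simp at this
    linarith
  obtain ⟨W, hW, hDW⟩ := exists_finite_convexHull_eq_polyhedron (fun w : V => (w - p : E))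
    (fun _ => 1) hDb
  refine ⟨W, hW, Subset.antisymm (fun x hx w hw => ?_) (fun x hx => ?_)⟩
  · refine hDconv w ?_ x hx
    rw [hD, hDW]
    exact subset_convexHull ℝ W hw
  -- A functional separating `x` from the hull, scaled by `1 / (c - q p)`, lies in the polar, where
  -- `x` satisfies the bound `1`.
  · by_contra hxP
    obtain ⟨q, c, hq, hqx⟩ := geometric_hahn_banach_closed_point (convex_convexHull ℝ V)
      (hV.isCompact_convexHull (𝕜 := ℝ)).isClosed hxP
    set y := (InnerProductSpace.toDual ℝ E).symm q with hy
    have hqy : ∀ z, q z = inner ℝ y z := fun z => by simp [hy]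
    have hc : 0 < c - q p := sub_pos.2 (hq p hpV)
    have hyD : (1 / (c - q p)) • y ∈ D := by
      intro w
      have := hq w (subset_convexHull ℝ V w.2)
      rw [real_inner_comm, inner_smul_left, inner_sub_right, ← hqy, ← hqy]
      simp only [RCLike.conj_to_real]
      rw [one_div, inv_mul_le_iff₀ hc]
      linarith
    rw [hD, hDW] at hyD
    have := inner_le_of_mem_convexHull (w := x - p) (c := 1) (V := W) (fun z hz => by
      rw [real_inner_comm]; exact hx z hz) _ hyD
    rw [real_inner_comm, inner_smul_left, inner_sub_right, ← hqy, ← hqy] at this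
    simp only [RCLike.conj_to_real] at this
    rw [one_div, inv_mul_le_iff₀ hc] at this
    linarith

end Polyhedra

/-! ### Irredundant descriptions of polytopes. -/

section Description

variable {n : ℕ}

theorem IsFullPolytope.isCompact {P : Set (Euc n)} (hP : IsFullPolytope P) : IsCompact P := by
  obtain ⟨⟨V, hV, rfl⟩, -⟩ := hP
  exact hV.isCompact_convexHull (𝕜 := ℝ)

theorem IsFullPolytope.convex {P : Set (Euc n)} (hP : IsFullPolytope P) : Convex ℝ P := by
  obtain ⟨⟨V, hV, rfl⟩, -⟩ := hP
  exact convex_convexHull ℝ V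

theorem IsFullPolytope.nonempty {P : Set (Euc n)} (hP : IsFullPolytope P) : P.Nonempty :=
  hP.2.mono interior_subset

theorem IsFullPolytope.isFullConvexBody {P : Set (Euc n)} (hP : IsFullPolytope P) :
    IsFullConvexBody P :=
  ⟨hP.convex, hP.isCompact, hP.2⟩

theorem IsFullPolytope.exists_description {P : Set (Euc n)} (hP : IsFullPolytope P) :
    ∃ (m : ℕ) (u : Fin m → Euc n) (b : Fin m → ℝ), (∀ i, ‖u i‖ = 1) ∧
      P = {x | ∀ i, inner ℝ (u i) x ≤ b i} := by
  classical
  obtain ⟨⟨V, hV, rfl⟩, p, hp⟩ := hP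
  obtain ⟨W, hW, hPW⟩ := exists_halfSpaces_of_convexHull hV hp
  -- A zero normal gives the trivial inequality `0 ≤ 1` and cannot be normalized, so it is dropped.
  set S := hW.toFinset.filter (· ≠ 0) with hS
  let w : Fin S.card → Euc n := fun i => (S.equivFin.symm i : Euc n)
  have hw : ∀ i, 0 < ‖w i‖ := fun i =>
    norm_pos_iff.2 (Finset.mem_filter.1 (S.equivFin.symm i).2).2
  refine ⟨S.card, fun i => ‖w i‖⁻¹ • w i, fun i => ‖w i‖⁻¹ * (1 + inner ℝ (w i) p),
    fun i => ?_, ?_⟩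
  · rw [norm_smul, norm_inv, norm_norm, inv_mul_cancel₀ (hw i).ne']
  · rw [hPW]
    ext x
    have key : ∀ i, inner ℝ (‖w i‖⁻¹ • w i) x ≤ ‖w i‖⁻¹ * (1 + inner ℝ (w i) p) ↔
        inner ℝ (w i) (x - p) ≤ 1 := fun i => by
      rw [inner_smul_left, RCLike.conj_to_real, mul_le_mul_iff_right₀ (inv_pos.2 (hw i)),
        inner_sub_right, sub_le_iff_le_add]
    simp only [mem_ofPred_eq, key]
    constructor
    · intro h i
      exact h _ (hW.mem_toFinset.1 (Finset.mem_filter.1 (S.equivFin.symm i).2).1)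
    · intro h z hz
      by_cases hz0 : z = 0
      · simp [hz0]
      · have hzS : z ∈ S := Finset.mem_filter.2 ⟨hW.mem_toFinset.2 hz, hz0⟩
        have := h (S.equivFin ⟨z, hzS⟩)
        simpa [w] using this

/-- A description with the fewest inequalities is irredundant, since deleting a superfluous one
would give a shorter description. -/
theorem IsFullPolytope.exists_irredundant {P : Set (Euc n)} (hP : IsFullPolytope P) :
    ∃ (m : ℕ) (u : Fin m → Euc n) (b : Fin m → ℝ), IsIrredundantDescription P u b := by
  classical
  have hex := hP.exists_description
  obtain ⟨u, b, hu, hPu⟩ := Nat.find_spec hex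
  refine ⟨Nat.find hex, u, b, hu, hPu, fun i hi => ?_⟩
  obtain ⟨k, hk⟩ : ∃ k, Nat.find hex = k + 1 := Nat.exists_eq_succ_of_ne_zero (by
    have := i.2; omega)
  have hmin := Nat.find_min hex (m := k) (by omega)
  revert u b i
  rw [hk]
  intro u b hu hPu i hi
  refine hmin ⟨fun j => u (i.succAbove j), fun j => b (i.succAbove j), fun j => hu _, ?_⟩
  rw [← hi]
  ext x
  simp only [mem_ofPred_eq]
  constructor
  · intro h j
    exact h _ (Fin.succAbove_ne i j)
  · intro h j hj
    obtain ⟨z, rfl⟩ := Fin.exists_succAbove_eq hj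
    exact h z

end Description

/-! ### Facets and the hyperplanes of an irredundant description. -/

section FacetsOfDescription

variable {n m : ℕ} {P : Set (Euc n)} {u : Fin m → Euc n} {b : Fin m → ℝ}

theorem IsIrredundantDescription.norm_eq (h : IsIrredundantDescription P u b) (i : Fin m) :
    ‖u i‖ = 1 :=
  h.1 i

theorem IsIrredundantDescription.mem_iff (h : IsIrredundantDescription P u b) {x : Euc n} :
    x ∈ P ↔ ∀ i, inner ℝ (u i) x ≤ b i := by
  conv_lhs => rw [h.2.1]
  rfl

theorem IsIrredundantDescription.mem_interior_iff (h : IsIrredundantDescription P u b)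
    {x : Euc n} : x ∈ interior P ↔ ∀ i, inner ℝ (u i) x < b i := by
  constructor
  · intro hx i
    have hc : Continuous fun t : ℝ => x + t • u i := by fun_prop
    have hev : ∀ᶠ t in 𝓝 (0 : ℝ), x + t • u i ∈ P :=
      (hc.tendsto' 0 x (by simp)).eventually (mem_interior_iff_mem_nhds.1 hx)
    obtain ⟨t, ht, ht0⟩ := ((hev.filter_mono nhdsWithin_le_nhds).and
      (self_mem_nhdsWithin (s := Ioi (0 : ℝ)))).exists
    have := h.mem_iff.1 ht i
    rw [inner_add_right, inner_smul_right, real_inner_self_eq_norm_sq, h.norm_eq] at this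
    have : (0 : ℝ) < t := ht0
    linarith
  · intro hx
    refine mem_interior.2 ⟨{y | ∀ i, inner ℝ (u i) y < b i},
      fun y hy => h.mem_iff.2 fun i => (hy i).le, ?_, hx⟩
    simp only [ofPred_forall]
    exact isOpen_iInter_of_finite fun i => isOpen_lt (by fun_prop) continuous_const

/-- By irredundancy some point violates inequality `i` alone. The segment to it from an interior
point crosses the hyperplane where all other inequalities are still strict. -/
theorem IsIrredundantDescription.exists_mem_hyperplane_lt (h : IsIrredundantDescription P u b)
    (hP : (interior P).Nonempty) (i : Fin m) :
    ∃ z, inner ℝ (u i) z = b i ∧ ∀ j, j ≠ i → inner ℝ (u j) z < b j := by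
  obtain ⟨p, hp⟩ := hP
  rw [h.mem_interior_iff] at hp
  obtain ⟨x, hx, hxi⟩ : ∃ x, (∀ j, j ≠ i → inner ℝ (u j) x ≤ b j) ∧ b i < inner ℝ (u i) x := by
    by_contra hcon
    push Not at hcon
    refine h.2.2 i (Subset.antisymm (fun x hx => h.mem_iff.2 fun j => ?_)
      fun x hx j _ => h.mem_iff.1 hx j)
    by_cases hj : j = i
    · exact hj ▸ hcon x hx
    · exact hx j hj
  have hpi := hp i
  have hden : 0 < inner ℝ (u i) x - inner ℝ (u i) p := by linarith
  set t := (b i - inner ℝ (u i) p) / (inner ℝ (u i) x - inner ℝ (u i) p) with ht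
  have ht0 : 0 < t := div_pos (by linarith) hden
  have ht1 : t < 1 := (div_lt_one hden).2 (by linarith)
  refine ⟨p + t • (x - p), ?_, fun j hj => ?_⟩
  · rw [inner_add_right, inner_smul_right, inner_sub_right, ht, div_mul_cancel₀ _ hden.ne']
    ring
  · rw [inner_add_right, inner_smul_right, inner_sub_right]
    nlinarith [hx j hj, hp j]

theorem vectorSpan_facetOf_le {w : Euc n} {c : ℝ} :
    vectorSpan ℝ (facetOf P w c) ≤ (ℝ ∙ w)ᗮ := by
  rw [vectorSpan_def, Submodule.span_le]
  rintro _ ⟨x, hx, y, hy, rfl⟩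
  rw [SetLike.mem_coe, Submodule.mem_orthogonal_singleton_iff_inner_right]
  change inner ℝ w (x - y) = 0
  rw [inner_sub_right, hx.2, hy.2, sub_self]

theorem IsIrredundantDescription.mem_facetOf_of_lt (h : IsIrredundantDescription P u b)
    {i : Fin m} {z : Euc n} (hz : inner ℝ (u i) z = b i)
    (hz' : ∀ j, j ≠ i → inner ℝ (u j) z < b j) : z ∈ facetOf P (u i) (b i) := by
  refine ⟨h.mem_iff.2 fun j => ?_, hz⟩
  by_cases hj : j = i
  · exact hj ▸ hz.le
  · exact (hz' j hj).le

theorem isOpen_setOf_forall_ne_inner_lt (i : Fin m) :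
    IsOpen {x : Euc n | ∀ j, j ≠ i → inner ℝ (u j) x < b j} := by
  simp only [ofPred_forall]
  exact isOpen_iInter_of_finite fun j => isOpen_iInter_of_finite fun _ =>
    isOpen_lt (by fun_prop) continuous_const

/-- Small moves within the hyperplane, starting at a point where all other inequalities are strict,
stay in the facet. -/
theorem IsIrredundantDescription.vectorSpan_facetOf (h : IsIrredundantDescription P u b)
    (hP : (interior P).Nonempty) (i : Fin m) :
    vectorSpan ℝ (facetOf P (u i) (b i)) = (ℝ ∙ u i)ᗮ := by
  refine le_antisymm vectorSpan_facetOf_le fun w hw => ?_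
  rw [Submodule.mem_orthogonal_singleton_iff_inner_right] at hw
  obtain ⟨z, hz, hz'⟩ := h.exists_mem_hyperplane_lt hP i
  have hc : Continuous fun t : ℝ => z + t • w := by fun_prop
  have hev := (hc.tendsto' 0 z (by simp)).eventually
    ((isOpen_setOf_forall_ne_inner_lt (u := u) (b := b) i).mem_nhds hz')
  obtain ⟨t, ht, ht0⟩ := ((hev.filter_mono nhdsWithin_le_nhds).and
    (self_mem_nhdsWithin (s := Ioi (0 : ℝ)))).exists
  have ht0 : (0 : ℝ) < t := ht0
  have hmem := vsub_mem_vectorSpan ℝ (h.mem_facetOf_of_lt (z := z + t • w)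
    (by rw [inner_add_right, inner_smul_right, hw, hz]; ring) ht) (h.mem_facetOf_of_lt hz hz')
  rw [vsub_eq_sub, add_sub_cancel_left] at hmem
  exact (Submodule.smul_mem_iff _ ht0.ne').1 hmem

theorem finrank_orthogonal_unit_add_one {w : Euc n} (hw : ‖w‖ = 1) :
    Module.finrank ℝ (ℝ ∙ w)ᗮ + 1 = n := by
  have h := (ℝ ∙ w).finrank_add_finrank_orthogonal
  have hw0 : w ≠ 0 := by
    rintro rfl
    simp at hw
  rw [finrank_span_singleton hw0, finrank_euclideanSpace_fin] at h
  omega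

theorem IsIrredundantDescription.affDim_facetOf (h : IsIrredundantDescription P u b)
    (hP : (interior P).Nonempty) (i : Fin m) :
    affDim (facetOf P (u i) (b i)) = Module.finrank ℝ (ℝ ∙ u i)ᗮ := by
  rw [affDim, h.vectorSpan_facetOf hP]

theorem IsIrredundantDescription.facetOf_mem_facets (h : IsIrredundantDescription P u b)
    (hP : (interior P).Nonempty) (i : Fin m) : facetOf P (u i) (b i) ∈ facets P := by
  obtain ⟨z, hz, hz'⟩ := h.exists_mem_hyperplane_lt hP i
  have hzF := h.mem_facetOf_of_lt hz hz'
  refine ⟨⟨z, hzF⟩, fun _ => ⟨innerSL ℝ (u i), ?_⟩, ?_⟩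
  · ext x
    constructor
    · rintro ⟨hx, hxi⟩
      refine ⟨hx, fun y hy => ?_⟩
      simpa [hxi] using h.mem_iff.1 hy i
    · rintro ⟨hx, hxi⟩
      refine ⟨hx, le_antisymm (h.mem_iff.1 hx i) ?_⟩
      simpa [hz] using hxi z hzF.1
  · rw [h.affDim_facetOf hP, finrank_orthogonal_unit_add_one (h.norm_eq i)]

theorem IsIrredundantDescription.facetOf_injective (h : IsIrredundantDescription P u b)
    (hP : (interior P).Nonempty) : Function.Injective fun i => facetOf P (u i) (b i) := by
  intro i j hij
  by_contra hne
  obtain ⟨z, hz, hz'⟩ := h.exists_mem_hyperplane_lt hP i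
  have hzF : z ∈ facetOf P (u j) (b j) := by
    have := h.mem_facetOf_of_lt hz hz'
    rwa [show facetOf P (u i) (b i) = facetOf P (u j) (b j) from hij] at this
  exact (hz' j (Ne.symm hne)).ne hzF.2

/-- A face contained in no bounding hyperplane contains an interior point of `P`, which forces its
functional to vanish and the face to be all of `P`. A facet therefore lies in some hyperplane, and
equality of dimensions makes its functional constant on the whole of that hyperplane's facet. -/
theorem IsIrredundantDescription.exists_facetOf_eq (h : IsIrredundantDescription P u b)
    (hP : (interior P).Nonempty) (hPc : Convex ℝ P) {F : Set (Euc n)} (hF : F ∈ facets P) :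
    ∃ i, facetOf P (u i) (b i) = F := by
  obtain ⟨⟨x₀, hx₀⟩, hexp, hdim⟩ := hF
  have hFc : Convex ℝ F := hexp.convex hPc
  have hFP : F ⊆ P := hexp.subset
  obtain ⟨l, hl⟩ := hexp ⟨x₀, hx₀⟩
  have hmax : ∀ x ∈ F, ∀ y ∈ P, l y ≤ l x := fun x hx => by
    rw [hl] at hx
    exact hx.2
  obtain ⟨i, hi⟩ : ∃ i, F ⊆ facetOf P (u i) (b i) := by
    by_contra hcon
    push Not at hcon
    have hlt : ∀ i, ∃ x ∈ F, inner ℝ (u i) x < b i := fun i => by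
      obtain ⟨x, hx, hxi⟩ := not_subset.1 (hcon i)
      exact ⟨x, hx, lt_of_le_of_ne (h.mem_iff.1 (hFP hx) i) fun heq => hxi ⟨hFP hx, heq⟩⟩
    -- Midpoints preserve strictness at each constraint, so finitely many of them make all
    -- constraints strict at once.
    have hall : ∀ S : Finset (Fin m), ∃ x ∈ F, ∀ i ∈ S, inner ℝ (u i) x < b i := by
      classical
      intro S
      induction S using Finset.induction_on with
      | empty => exact ⟨x₀, hx₀, by simp⟩
      | insert j S _ ih =>
        obtain ⟨x, hx, hxS⟩ := ih
        obtain ⟨y, hy, hyj⟩ := hlt j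
        refine ⟨(1 / 2 : ℝ) • x + (1 / 2 : ℝ) • y,
          hFc hx hy (by norm_num) (by norm_num) (by norm_num), fun i hi => ?_⟩
        rw [inner_add_right, inner_smul_right, inner_smul_right]
        have h1 := h.mem_iff.1 (hFP hx)
        have h2 := h.mem_iff.1 (hFP hy)
        rcases Finset.mem_insert.1 hi with rfl | hi
        · linarith [h1 i]
        · linarith [h2 i, hxS i hi]
    obtain ⟨x, hx, hxu⟩ := hall Finset.univ
    have hxint : x ∈ interior P := h.mem_interior_iff.2 fun i => hxu i (Finset.mem_univ i)
    have hl0 : ∀ w, l w ≤ 0 := fun w => by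
      have hc : Continuous fun t : ℝ => x + t • w := by fun_prop
      have hev : ∀ᶠ t in 𝓝 (0 : ℝ), x + t • w ∈ P :=
        (hc.tendsto' 0 x (by simp)).eventually (mem_interior_iff_mem_nhds.1 hxint)
      obtain ⟨t, ht, ht0⟩ := ((hev.filter_mono nhdsWithin_le_nhds).and
        (self_mem_nhdsWithin (s := Ioi (0 : ℝ)))).exists
      have := hmax x hx _ ht
      rw [map_add, map_smul, smul_eq_mul] at this
      have ht0 : (0 : ℝ) < t := ht0
      nlinarith
    have hl0' : ∀ w, l w = 0 := fun w => le_antisymm (hl0 w) (by simpa using hl0 (-w))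
    have hFP' : F = P := by
      rw [hl]
      ext y
      simp [hl0']
    have htop : vectorSpan ℝ P = ⊤ := by
      rw [← direction_affineSpan, hPc.interior_nonempty_iff_affineSpan_eq_top.1 hP,
        AffineSubspace.direction_top]
    rw [hFP', affDim, htop, finrank_top, finrank_euclideanSpace_fin] at hdim
    omega
  refine ⟨i, Subset.antisymm (fun x hx => ?_) hi⟩
  have hspan : vectorSpan ℝ F = vectorSpan ℝ (facetOf P (u i) (b i)) := by
    refine Submodule.eq_of_le_of_finrank_eq (vectorSpan_mono ℝ hi) ?_
    have h1 := h.affDim_facetOf hP i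
    have h2 := finrank_orthogonal_unit_add_one (h.norm_eq i)
    rw [affDim] at h1 hdim
    omega
  have hker : vectorSpan ℝ F ≤ LinearMap.ker (l : Euc n →ₗ[ℝ] ℝ) := by
    rw [vectorSpan_def, Submodule.span_le]
    rintro _ ⟨x, hx, y, hy, rfl⟩
    simp [le_antisymm (hmax y hy x (hFP hx)) (hmax x hx y (hFP hy))]
  have hx' : l (x - x₀) = 0 := hker (hspan ▸ vsub_mem_vectorSpan ℝ hx (hi hx₀))
  rw [map_sub, sub_eq_zero] at hx'
  rw [hl]
  exact ⟨hx.1, fun y hy => hx' ▸ hmax x₀ hx₀ y hy⟩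

/-- The facets are the intersections with the hyperplanes of an irredundant description. -/
theorem IsIrredundantDescription.facets_eq_range (h : IsIrredundantDescription P u b)
    (hP : (interior P).Nonempty) (hPc : Convex ℝ P) :
    facets P = range fun i => facetOf P (u i) (b i) :=
  Subset.antisymm (fun _ hF => h.exists_facetOf_eq hP hPc hF)
    (range_subset_iff.2 fun i => h.facetOf_mem_facets hP i)

theorem IsIrredundantDescription.mem_intrinsicInterior (h : IsIrredundantDescription P u b)
    {i : Fin m} {z : Euc n} (hz : inner ℝ (u i) z = b i)
    (hz' : ∀ j, j ≠ i → inner ℝ (u j) z < b j) :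
    z ∈ intrinsicInterior ℝ (facetOf P (u i) (b i)) := by
  have hzF := h.mem_facetOf_of_lt hz hz'
  rw [_root_.mem_intrinsicInterior]
  refine ⟨⟨z, subset_affineSpan ℝ _ hzF⟩, mem_interior.2
    ⟨Subtype.val ⁻¹' {x : Euc n | ∀ j, j ≠ i → inner ℝ (u j) x < b j}, fun y hy => ?_,
    (isOpen_setOf_forall_ne_inner_lt i).preimage continuous_subtype_val, hz'⟩, rfl⟩
  refine h.mem_facetOf_of_lt ?_ hy
  have hdir := vectorSpan_facetOf_le (direction_affineSpan ℝ (facetOf P (u i) (b i)) ▸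
    AffineSubspace.vsub_mem_direction y.2 (subset_affineSpan ℝ _ hzF))
  rw [Submodule.mem_orthogonal_singleton_iff_inner_right, vsub_eq_sub, inner_sub_right, hz,
    sub_eq_zero] at hdir
  exact hdir

theorem IsIrredundantDescription.facetOf_subset_frontier (h : IsIrredundantDescription P u b)
    (i : Fin m) : facetOf P (u i) (b i) ⊆ frontier P := fun _ hx =>
  ⟨subset_closure hx.1, fun hint => (h.mem_interior_iff.1 hint i).ne hx.2⟩

end FacetsOfDescription

/-! ### Canonical extensions as finite minima. -/

section CanonicalExtension

variable {n : ℕ}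

/-- In a family of minimal cardinality, a member that is nowhere strictly smallest could be erased.
Nonemptiness of `K` covers a family with one member. -/
theorem exists_isIrredundantFamily {K : Set (Euc n)} (hK : K.Nonempty) {f : Euc n → ℝ}
    (hf : IsPiecewiseAffineConcaveOn K f) : ∃ H, IsIrredundantFamily K f H := by
  classical
  have hex : ∃ k, ∃ (H : Finset (Euc n →ᵃ[ℝ] ℝ)) (hH : H.Nonempty),
      H.card = k ∧ ∀ x ∈ K, f x = minOf H hH x := by
    obtain ⟨H, hH, h⟩ := hf
    exact ⟨_, H, hH, rfl, h⟩
  obtain ⟨H, hH, hcard, hmin⟩ := Nat.find_spec hex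
  refine ⟨H, ⟨hH, hmin⟩, fun h hh => ?_⟩
  rcases (H.erase h).eq_empty_or_nonempty with hempty | hne
  · obtain ⟨x, hx⟩ := hK
    refine ⟨x, hx, fun g hg hgh => ?_⟩
    have : g ∈ H.erase h := Finset.mem_erase.2 ⟨hgh, hg⟩
    simp [hempty] at this
  · have hlt : (H.erase h).card < Nat.find hex := hcard ▸ Finset.card_erase_lt_of_mem hh
    have hnot := Nat.find_min hex hlt
    by_contra hcon
    push Not at hcon
    refine hnot ⟨H.erase h, hne, rfl, fun x hx => ?_⟩
    rw [hmin x hx]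
    refine le_antisymm (Finset.inf'_mono _ (Finset.erase_subset _ _) hne) ?_
    obtain ⟨g, hg, hgh, hle⟩ := hcon x hx
    refine (Finset.le_inf'_iff _ _).2 fun k hk => ?_
    by_cases hkh : k = h
    · subst hkh
      exact (Finset.inf'_le _ (Finset.mem_erase.2 ⟨hgh, hg⟩)).trans hle
    · exact Finset.inf'_le _ (Finset.mem_erase.2 ⟨hkh, hk⟩)

/-- These are the only properties of the canonical extension needed later; uniqueness of the family
plays no role. -/
theorem exists_canonicalExtension_eq_minOf {K : Set (Euc n)} (hK : K.Nonempty) {f : Euc n → ℝ}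
    (hf : IsPiecewiseAffineConcaveOn K f) :
    ∃ (H : Finset (Euc n →ᵃ[ℝ] ℝ)) (hH : H.Nonempty), canonicalExtension K f = minOf H hH ∧
      ∀ x ∈ K, f x = canonicalExtension K f x := by
  have h := exists_isIrredundantFamily hK hf
  rw [canonicalExtension, dif_pos h]
  exact ⟨h.choose, h.choose_spec.1.choose, rfl, h.choose_spec.1.choose_spec⟩

theorem continuous_minOf (H : Finset (Euc n →ᵃ[ℝ] ℝ)) (hH : H.Nonempty) :
    Continuous (minOf H hH) :=
  Continuous.finset_inf'_apply hH fun h _ => h.continuous_of_finiteDimensional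

end CanonicalExtension

/-! ### The splitting along `v` and the Jacobian of a lift to a hyperplane. -/

section Hyperplanes

variable {n : ℕ} {v : Euc n}

theorem proj_coe_add_smul (y : (ℝ ∙ v)ᗮ) (s : ℝ) : proj v ((y : Euc n) + s • v) = y := by
  have h1 : (ℝ ∙ v)ᗮ.starProjection (y : Euc n) = y :=
    Submodule.starProjection_eq_self_iff.2 y.2
  have h2 : (ℝ ∙ v)ᗮ.starProjection v = 0 := by
    rw [Submodule.starProjection_apply_eq_zero_iff, Submodule.orthogonal_orthogonal]
    exact Submodule.mem_span_singleton_self v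
  rw [proj, map_add, map_smul, h1, h2, smul_zero, add_zero]

theorem proj_coe (y : (ℝ ∙ v)ᗮ) : proj v (y : Euc n) = y := by
  simpa using proj_coe_add_smul y 0

theorem proj_mem (x : Euc n) : proj v x ∈ (ℝ ∙ v)ᗮ :=
  Submodule.starProjection_apply_mem _ x

theorem proj_proj (x : Euc n) : proj v (proj v x) = proj v x :=
  proj_coe ⟨proj v x, proj_mem x⟩

theorem continuous_proj : Continuous (proj v) :=
  (ℝ ∙ v)ᗮ.starProjection.continuous

theorem inner_coe_orthogonal (y : (ℝ ∙ v)ᗮ) : inner ℝ v (y : Euc n) = 0 :=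
  Submodule.mem_orthogonal_singleton_iff_inner_right.1 y.2

theorem proj_add_inner_smul (hv : ‖v‖ = 1) (x : Euc n) : proj v x + inner ℝ v x • v = x := by
  have h := Submodule.starProjection_add_starProjection_orthogonal (K := ℝ ∙ v) x
  rw [Submodule.starProjection_unit_singleton ℝ hv, add_comm] at h
  exact h

theorem inner_coe_add_smul (hv : ‖v‖ = 1) (y : (ℝ ∙ v)ᗮ) (s : ℝ) :
    inner ℝ v ((y : Euc n) + s • v) = s := by
  rw [inner_add_right, inner_coe_orthogonal, inner_smul_right, real_inner_self_eq_norm_sq, hv]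
  ring

theorem continuous_height (w : Euc n) (c : ℝ) : Continuous (height v w c) := by
  have := continuous_proj (v := v)
  unfold height
  fun_prop

theorem continuous_lift (w : Euc n) (c : ℝ) : Continuous (lift v w c) := by
  have := continuous_height (v := v) w c
  unfold lift
  fun_prop

theorem height_coe_add_smul (w : Euc n) (c : ℝ) (y : (ℝ ∙ v)ᗮ) (s : ℝ) :
    height v w c ((y : Euc n) + s • v) = height v w c y := by
  rw [height, height, proj_coe_add_smul, proj_coe]

theorem height_coe (w : Euc n) (c : ℝ) (y : (ℝ ∙ v)ᗮ) :
    height v w c (y : Euc n) = (c - inner ℝ w (y : Euc n)) / inner ℝ w v := by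
  rw [height, proj_coe]
  ring

theorem inner_lift_coe {w : Euc n} (hw : inner ℝ w v ≠ 0) (c : ℝ) (y : (ℝ ∙ v)ᗮ) :
    inner ℝ w (lift v w c (y : Euc n)) = c := by
  rw [lift, height_coe, inner_add_right, inner_smul_right, div_mul_cancel₀ _ hw]
  ring

theorem measurePreserving_coe_add_smul (hv : ‖v‖ = 1) :
    MeasurePreserving (fun p : (ℝ ∙ v)ᗮ × ℝ => (p.1 : Euc n) + p.2 • v) := by
  have h1 : MeasurePreserving (Prod.swap : (ℝ ∙ v)ᗮ × ℝ → ℝ × (ℝ ∙ v)ᗮ) :=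
    Measure.measurePreserving_swap
  have h2 := (LinearIsometryEquiv.toSpanUnitSingleton (𝕜 := ℝ) v hv).measurePreserving.prod
    (MeasurePreserving.id (volume : Measure (ℝ ∙ v)ᗮ))
  have h3 := WithLp.volume_preserving_toLp (ℝ ∙ v) (ℝ ∙ v)ᗮ
  have h4 := (ℝ ∙ v).orthogonalDecomposition.symm.measurePreserving
  have h := h4.comp (h3.comp (h2.comp h1))
  have heq : (fun p : (ℝ ∙ v)ᗮ × ℝ => (p.1 : Euc n) + p.2 • v) =
      (ℝ ∙ v).orthogonalDecomposition.symm ∘ WithLp.toLp 2 ∘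
        Prod.map (LinearIsometryEquiv.toSpanUnitSingleton (𝕜 := ℝ) v hv) id ∘ Prod.swap := by
    funext p
    simp [add_comm]
  rw [heq]
  exact h

theorem measurableEmbedding_coe_add_smul (hv : ‖v‖ = 1) :
    MeasurableEmbedding (fun p : (ℝ ∙ v)ᗮ × ℝ => (p.1 : Euc n) + p.2 • v) := by
  refine Continuous.measurableEmbedding (by fun_prop) fun p q hpq => ?_
  have h1 := congrArg (proj v) hpq
  have h2 := congrArg (inner ℝ v) hpq
  simp only [proj_coe_add_smul, inner_coe_add_smul hv] at h1 h2
  exact Prod.ext (Subtype.ext h1) h2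

/-- The parametrization of a hyperplane through `0` by its projection to `v^⊥`. -/
noncomputable def linearLift (v w : Euc n) : (ℝ ∙ v)ᗮ →ₗ[ℝ] Euc n :=
  (ℝ ∙ v)ᗮ.subtype - ((inner ℝ w v)⁻¹ • (innerₗ (Euc n) w ∘ₗ (ℝ ∙ v)ᗮ.subtype)).smulRight v

theorem linearLift_apply (w : Euc n) (y : (ℝ ∙ v)ᗮ) :
    linearLift v w y = (y : Euc n) - (inner ℝ w (y : Euc n) / inner ℝ w v) • v := by
  simp [linearLift, div_eq_inv_mul]

/-- The Gram operator of the lift is the identity plus a rank-one map, a transvection along the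
projection of `w` to `v^⊥`. Its determinant is `1 + (1 - d ^ 2) / d ^ 2 = 1 / d ^ 2`. -/
theorem normDet_linearLift (hv : ‖v‖ = 1) {w : Euc n} (hw : ‖w‖ = 1) (hwv : inner ℝ w v ≠ 0) :
    (linearLift v w).normDet = |inner ℝ w v|⁻¹ := by
  set d := inner ℝ w v with hd
  have hvv : inner ℝ v v = (1 : ℝ) := by rw [real_inner_self_eq_norm_sq, hv, one_pow]
  have hww : inner ℝ w w = (1 : ℝ) := by rw [real_inner_self_eq_norm_sq, hw, one_pow]
  have hmem : w - d • v ∈ (ℝ ∙ v)ᗮ := by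
    rw [Submodule.mem_orthogonal_singleton_iff_inner_right, inner_sub_right, inner_smul_right,
      hvv, real_inner_comm, hd]
    ring
  have horth : ∀ y : (ℝ ∙ v)ᗮ, inner ℝ (y : Euc n) v = 0 := fun y => by
    rw [real_inner_comm, inner_coe_orthogonal]
  set a : (ℝ ∙ v)ᗮ := ⟨w - d • v, hmem⟩ with ha
  set φ : Module.Dual ℝ (ℝ ∙ v)ᗮ := (d ^ 2)⁻¹ • (innerₗ (Euc n) w ∘ₗ (ℝ ∙ v)ᗮ.subtype) with hφ
  have hadj : (linearLift v w).adjoint ∘ₗ linearLift v w = LinearMap.transvection φ a := by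
    refine LinearMap.ext fun x => ext_inner_right ℝ fun y => ?_
    rw [LinearMap.comp_apply, LinearMap.adjoint_inner_left, linearLift_apply, linearLift_apply,
      LinearMap.transvection.apply, inner_add_left, inner_smul_left, Submodule.coe_inner,
      Submodule.coe_inner]
    simp only [hφ, ha, inner_sub_left, inner_sub_right, inner_smul_left, inner_smul_right,
      inner_coe_orthogonal, horth, hvv, ← hd, LinearMap.smul_apply, LinearMap.comp_apply,
      innerₗ_apply_apply, Submodule.subtype_apply, RCLike.conj_to_real, smul_eq_mul]
    field_simp
    ring
  have hsq := (linearLift v w).normDet_sq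
  rw [hadj, LinearMap.transvection.det] at hsq
  have hφa : 1 + φ a = (|d|⁻¹) ^ 2 := by
    simp only [hφ, ha, LinearMap.smul_apply, LinearMap.comp_apply, innerₗ_apply_apply,
      Submodule.subtype_apply, inner_sub_right, inner_smul_right, hww, ← hd, smul_eq_mul,
      inv_pow, sq_abs]
    field_simp
    ring
  rw [hφa] at hsq
  exact (sq_eq_sq₀ (LinearMap.normDet_nonneg _) (by positivity)).1 (by exact_mod_cast hsq)

theorem lift_coe_eq (w : Euc n) (c : ℝ) (y : (ℝ ∙ v)ᗮ) :
    lift v w c (y : Euc n) = linearLift v w y + (c / inner ℝ w v) • v := by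
  rw [lift, height_coe, linearLift_apply, sub_div, sub_smul]
  abel

/-- The Euclidean volume on a hyperplane is obtained from the volume on `v^⊥` by lifting and
scaling with `1 / |⟨w, v⟩|`. -/
theorem restrict_hyperplane_euclideanHausdorffMeasure (hv : ‖v‖ = 1) {w : Euc n} (hw : ‖w‖ = 1)
    (hwv : inner ℝ w v ≠ 0) (c : ℝ) :
    (Measure.euclideanHausdorffMeasure (Module.finrank ℝ (ℝ ∙ v)ᗮ)).restrict
        {x : Euc n | inner ℝ w x = c} =
      ENNReal.ofReal |inner ℝ w v|⁻¹ •
        (volume : Measure (ℝ ∙ v)ᗮ).map fun y : (ℝ ∙ v)ᗮ => lift v w c (y : Euc n) := by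
  have hmeas : Measurable fun y : (ℝ ∙ v)ᗮ => lift v w c (y : Euc n) :=
    ((continuous_lift w c).comp continuous_subtype_val).measurable
  ext A hA
  -- The part of `A` in the affine hyperplane is a translate of a linear image, so translation
  -- invariance reduces the claim to the linear Jacobian.
  have hset : IsometryEquiv.addRight ((c / inner ℝ w v) • v) ''
      (linearLift v w '' ((fun y : (ℝ ∙ v)ᗮ => lift v w c (y : Euc n)) ⁻¹' A)) =
        A ∩ {x : Euc n | inner ℝ w x = c} := by
    ext x
    simp only [mem_inter_iff, mem_ofPred_eq, image_image, mem_image, mem_preimage,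
      IsometryEquiv.addRight_apply, ← lift_coe_eq]
    constructor
    · rintro ⟨y, hy, rfl⟩
      exact ⟨hy, inner_lift_coe hwv c y⟩
    · rintro ⟨hxA, hx⟩
      have h := proj_add_inner_smul hv x
      have hcoef : (c - inner ℝ w (proj v x)) / inner ℝ w v = inner ℝ v x := by
        rw [div_eq_iff hwv, ← hx]
        nth_rw 1 [← h]
        rw [inner_add_right, inner_smul_right]
        ring
      have hlift : lift v w c (⟨proj v x, proj_mem x⟩ : (ℝ ∙ v)ᗮ) = x := by
        rw [lift, height_coe, hcoef, h]
      exact ⟨_, by rwa [hlift], hlift⟩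
  rw [Measure.restrict_apply hA, Measure.smul_apply, Measure.map_apply hmeas hA, smul_eq_mul,
    ← normDet_linearLift hv hw hwv, ← LinearMap.euclideanHausdorffMeasure_image_eq_normDet_mul_volume,
    ← hset, Isometry.euclideanHausdorffMeasure_image (IsometryEquiv.isometry _)]

end Hyperplanes

/-! ### Facet integrals over `v^⊥`, and generic fibres. -/

section Hyperplanes

variable {n : ℕ} {v : Euc n}

theorem measurableEmbedding_lift (w : Euc n) (c : ℝ) :
    MeasurableEmbedding fun y : (ℝ ∙ v)ᗮ => lift v w c (y : Euc n) := by
  refine Continuous.measurableEmbedding ((continuous_lift w c).comp continuous_subtype_val)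
    fun y z hyz => Subtype.ext ?_
  have h := congrArg (proj v) hyz
  simpa only [lift, proj_coe_add_smul] using h

/-- The dimension hypothesis ensures that `relVolume` uses the Hausdorff measure of the dimension of
`v^⊥`. -/
theorem relVolume_eq_map_lift (hv : ‖v‖ = 1) {w : Euc n} (hw : ‖w‖ = 1)
    (hwv : inner ℝ w v ≠ 0) {c : ℝ} {F : Set (Euc n)} (hF : MeasurableSet F)
    (hFc : ∀ x ∈ F, inner ℝ w x = c) (hdim : affDim F = Module.finrank ℝ (ℝ ∙ v)ᗮ) :
    relVolume F = ENNReal.ofReal |inner ℝ w v|⁻¹ •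
      ((volume : Measure (ℝ ∙ v)ᗮ).restrict
        ((fun y : (ℝ ∙ v)ᗮ => lift v w c (y : Euc n)) ⁻¹' F)).map
          fun y : (ℝ ∙ v)ᗮ => lift v w c (y : Euc n) := by
  rw [relVolume, hdim, ← Measure.restrict_map (measurableEmbedding_lift w c).measurable hF,
    ← Measure.restrict_smul, ← restrict_hyperplane_euclideanHausdorffMeasure hv hw hwv,
    Measure.restrict_restrict hF,
    show F ∩ {x : Euc n | inner ℝ w x = c} = F from inter_eq_self_of_subset_left hFc]

theorem integral_relVolume (hv : ‖v‖ = 1) {w : Euc n} (hw : ‖w‖ = 1)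
    (hwv : inner ℝ w v ≠ 0) {c : ℝ} {F : Set (Euc n)} (hF : MeasurableSet F)
    (hFc : ∀ x ∈ F, inner ℝ w x = c) (hdim : affDim F = Module.finrank ℝ (ℝ ∙ v)ᗮ)
    (G : Euc n → ℝ) :
    ∫ x, G x ∂(relVolume F) = |inner ℝ w v|⁻¹ *
      ∫ y in (fun y : (ℝ ∙ v)ᗮ => lift v w c (y : Euc n)) ⁻¹' F, G (lift v w c (y : Euc n)) := by
  rw [relVolume_eq_map_lift hv hw hwv hF hFc hdim, integral_smul_measure,
    (measurableEmbedding_lift w c).integral_map, ENNReal.toReal_ofReal (by positivity), smul_eq_mul]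

theorem ae_relVolume_of_ae (hv : ‖v‖ = 1) {w : Euc n} (hw : ‖w‖ = 1)
    (hwv : inner ℝ w v ≠ 0) {c : ℝ} {F : Set (Euc n)} (hF : MeasurableSet F)
    (hFc : ∀ x ∈ F, inner ℝ w x = c) (hdim : affDim F = Module.finrank ℝ (ℝ ∙ v)ᗮ)
    {p : Euc n → Prop}
    (hp : ∀ᵐ y : (ℝ ∙ v)ᗮ, lift v w c (y : Euc n) ∈ F → p (lift v w c (y : Euc n))) :
    ∀ᵐ x ∂(relVolume F), p x := by
  rw [relVolume_eq_map_lift hv hw hwv hF hFc hdim]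
  refine Measure.ae_smul_measure ?_ _
  rw [(measurableEmbedding_lift w c).ae_map_iff, ae_restrict_iff'
    ((measurableEmbedding_lift w c).measurable hF)]
  exact hp

theorem inner_coe_add_smul_eq_iff {w : Euc n} (hw : inner ℝ w v ≠ 0) (c : ℝ)
    (y : (ℝ ∙ v)ᗮ) (s : ℝ) :
    inner ℝ w ((y : Euc n) + s • v) = c ↔ s = height v w c y := by
  rw [height_coe, inner_add_right, inner_smul_right, eq_div_iff hw]
  constructor <;> intro h <;> linarith

/-- The difference of two heights is affine on `v^⊥`; unless it vanishes identically, its zero set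
is a proper affine subspace and hence null. -/
theorem ae_height_ne {w₁ w₂ : Euc n} {c₁ c₂ : ℝ}
    (h : ∃ y : (ℝ ∙ v)ᗮ, height v w₁ c₁ (y : Euc n) ≠ height v w₂ c₂ y) :
    ∀ᵐ y : (ℝ ∙ v)ᗮ, height v w₁ c₁ (y : Euc n) ≠ height v w₂ c₂ y := by
  set A : (ℝ ∙ v)ᗮ →ᵃ[ℝ] ℝ :=
    ((inner ℝ w₂ v)⁻¹ • (innerₗ (Euc n) w₂ ∘ₗ (ℝ ∙ v)ᗮ.subtype) -
      (inner ℝ w₁ v)⁻¹ • (innerₗ (Euc n) w₁ ∘ₗ (ℝ ∙ v)ᗮ.subtype)).toAffineMap +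
      AffineMap.const ℝ _ (c₁ / inner ℝ w₁ v - c₂ / inner ℝ w₂ v) with hA
  have hAy : ∀ y : (ℝ ∙ v)ᗮ, A y = height v w₁ c₁ (y : Euc n) - height v w₂ c₂ y := fun y => by
    rw [height_coe, height_coe]
    simp [hA]
    ring
  set S : AffineSubspace ℝ (ℝ ∙ v)ᗮ := (AffineSubspace.mk' (0 : ℝ) ⊥).comap A with hS
  have hmem : ∀ y, y ∈ S ↔ height v w₁ c₁ (y : Euc n) = height v w₂ c₂ y := fun y => by
    simp [hS, AffineSubspace.mem_comap, AffineSubspace.mem_mk', hAy, sub_eq_zero]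
  have hS' : S ≠ ⊤ := by
    rintro htop
    obtain ⟨y, hy⟩ := h
    exact hy ((hmem y).1 (htop ▸ AffineSubspace.mem_top ℝ _ y))
  have h0 := Measure.addHaar_affineSubspace (volume : Measure (ℝ ∙ v)ᗮ) S hS'
  rw [ae_iff]
  convert h0 using 2
  ext y
  simp [hmem]

/-- A point of facet `i` off all other hyperplanes shows that no two height functions coincide, so
only finitely many null sets are excluded. -/
theorem IsIrredundantDescription.ae_height_injective {m : ℕ} {P : Set (Euc n)}
    {u : Fin m → Euc n} {b : Fin m → ℝ} (h : IsIrredundantDescription P u b)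
    (hP : (interior P).Nonempty) (hv : IsGeneric u v) :
    ∀ᵐ y : (ℝ ∙ v)ᗮ, Function.Injective fun i => height v (u i) (b i) (y : Euc n) := by
  have hall : ∀ᵐ y : (ℝ ∙ v)ᗮ, ∀ i j, i ≠ j →
      height v (u i) (b i) (y : Euc n) ≠ height v (u j) (b j) y := by
    refine ae_all_iff.2 fun i => ae_all_iff.2 fun j => ?_
    by_cases hij : i = j
    · simp [hij]
    obtain ⟨z, hz, hz'⟩ := h.exists_mem_hyperplane_lt hP i
    have := ae_height_ne (v := v) (w₁ := u i) (w₂ := u j) (c₁ := b i) (c₂ := b j)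
      ⟨⟨proj v z, proj_mem z⟩, fun heq => by
        have hdec := proj_add_inner_smul hv.1 z
        have h1 := (inner_coe_add_smul_eq_iff (hv.2 i) (b i) ⟨proj v z, proj_mem z⟩
          (inner ℝ v z)).1 (by rw [hdec, hz])
        rw [heq, ← inner_coe_add_smul_eq_iff (hv.2 j), hdec] at h1
        exact (hz' j (Ne.symm hij)).ne h1⟩
    filter_upwards [this] with y hy _ using hy
  filter_upwards [hall] with y hy i j hij
  by_contra hne
  exact hy i j hne hij

end Hyperplanes

/-! ### The one-dimensional problem on a single fibre. -/

section Slab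

variable {ι : Type*}

/-- The interval of the real line lying below the points `a i + t α i` with `d i > 0` and above the
points `a i - t α i` with `d i < 0`. -/
def slab (d a α : ι → ℝ) (t : ℝ) : Set ℝ :=
  {s | (∀ i, 0 < d i → s ≤ a i + t * α i) ∧ ∀ i, d i < 0 → a i - t * α i ≤ s}

theorem measurableSet_slab [Finite ι] (d a α : ι → ℝ) (t : ℝ) : MeasurableSet (slab d a α t) := by
  have : slab d a α t = (⋂ i, ⋂ _ : 0 < d i, Iic (a i + t * α i)) ∩
      ⋂ i, ⋂ _ : d i < 0, Ici (a i - t * α i) := by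
    ext s
    simp [slab]
  rw [this]
  exact (MeasurableSet.iInter fun i => MeasurableSet.iInter fun _ => measurableSet_Iic).inter
    (MeasurableSet.iInter fun i => MeasurableSet.iInter fun _ => measurableSet_Ici)

theorem hasDerivAt_integral_Icc {φ : ℝ → ℝ} (hφ : Continuous φ) {l r l' r' : ℝ}
    (hlr : l < r) :
    HasDerivAt (fun t : ℝ => ∫ s in Icc (l - t * l') (r + t * r'), φ s)
      (φ r * r' + φ l * l') 0 := by
  set Φ : ℝ → ℝ := fun x => ∫ s in (0 : ℝ)..x, φ s
  have hΦ : ∀ x, HasDerivAt Φ (φ x) x := fun x => (hφ.integral_hasStrictDerivAt 0 x).hasDerivAt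
  have hr : HasDerivAt (fun t : ℝ => r + t * r') r' 0 := by
    simpa using ((hasDerivAt_id (0 : ℝ)).mul_const r').const_add r
  have hl : HasDerivAt (fun t : ℝ => l - t * l') (-l') 0 := by
    simpa using ((hasDerivAt_id (0 : ℝ)).mul_const l').const_sub l
  have h1 := HasDerivAt.comp_of_eq (0 : ℝ) (hΦ r) hr (by simp)
  have h2 := HasDerivAt.comp_of_eq (0 : ℝ) (hΦ l) hl (by simp)
  have h := h1.sub h2
  -- While the endpoints keep their order, the integral over `Icc` is an oriented interval integral.
  have hev : ∀ᶠ t : ℝ in 𝓝 0, l - t * l' < r + t * r' := by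
    have hc1 : Continuous fun t : ℝ => l - t * l' := by fun_prop
    have hc2 : Continuous fun t : ℝ => r + t * r' := by fun_prop
    exact (hc1.tendsto' 0 l (by simp)).eventually_lt (hc2.tendsto' 0 r (by simp)) hlr
  have h' : φ r * r' + φ l * l' = φ r * r' - φ l * -l' := by ring
  rw [h']
  refine h.congr_of_eventuallyEq ?_
  filter_upwards [hev] with t ht
  rw [integral_Icc_eq_integral_Ioc, ← intervalIntegral.integral_of_le ht.le]
  exact (intervalIntegral.integral_interval_sub_left (hφ.intervalIntegrable _ _)
    (hφ.intervalIntegrable _ _)).symm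

/-- Since the `a i` are distinct, the lowest upper bound `r` and the highest lower bound `l` are
unique and stay decisive for small `t`. Every other `a i` lies outside the slab at time `0`, so its
indicator removes it from the sum. -/
theorem hasDerivAt_integral_slab [Fintype ι] {d a α : ι → ℝ} (hd : ∀ i, d i ≠ 0)
    (hpos : ∃ i, 0 < d i) (hneg : ∃ i, d i < 0) (ha : Function.Injective a)
    (hne : (slab d a α 0).Nonempty) {φ : ℝ → ℝ} (hφ : Continuous φ) :
    HasDerivAt (fun t : ℝ => ∫ s in slab d a α t, φ s)
      (∑ i, (slab d a α 0).indicator φ (a i) * α i) 0 := by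
  classical
  obtain ⟨r, hr, hrmin⟩ := Finset.exists_min_image (Finset.univ.filter fun i => 0 < d i) a
    (by simpa [Finset.filter_nonempty_iff] using hpos)
  obtain ⟨l, hl, hlmax⟩ := Finset.exists_max_image (Finset.univ.filter fun i => d i < 0) a
    (by simpa [Finset.filter_nonempty_iff] using hneg)
  simp only [Finset.mem_filter, Finset.mem_univ, true_and] at hr hrmin hl hlmax
  have hlr_ne : l ≠ r := by
    rintro rfl
    linarith
  have hslab0 : slab d a α 0 = Icc (a l) (a r) := by
    ext s
    simp only [slab, zero_mul, add_zero, sub_zero, mem_ofPred_eq, mem_Icc]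
    exact ⟨fun h => ⟨h.2 l hl, h.1 r hr⟩,
      fun h => ⟨fun i hi => h.2.trans (hrmin i hi), fun i hi => (hlmax i hi).trans h.1⟩⟩
  have hlr : a l < a r := by
    rw [hslab0, nonempty_Icc] at hne
    exact lt_of_le_of_ne hne fun h => hlr_ne (ha h)
  have hr' : ∀ i, 0 < d i → i ≠ r → a r < a i := fun i hi hir =>
    lt_of_le_of_ne (hrmin i hi) fun h => hir (ha h.symm)
  have hl' : ∀ i, d i < 0 → i ≠ l → a i < a l := fun i hi hil =>
    lt_of_le_of_ne (hlmax i hi) fun h => hil (ha h)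
  have hsum : ∑ i, (slab d a α 0).indicator φ (a i) * α i = φ (a r) * α r + φ (a l) * α l := by
    rw [hslab0, Finset.sum_eq_add r l hlr_ne.symm]
    · rw [indicator_of_mem (right_mem_Icc.2 hlr.le), indicator_of_mem (left_mem_Icc.2 hlr.le)]
    · rintro i - ⟨hir, hil⟩
      rw [indicator_of_notMem, zero_mul]
      rintro ⟨h1, h2⟩
      rcases (hd i).lt_or_gt with hi | hi
      · exact absurd (hl' i hi hil) (not_lt.2 h1)
      · exact absurd (hr' i hi hir) (not_lt.2 h2)
    · simp
    · simp
  rw [hsum]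
  refine (hasDerivAt_integral_Icc hφ (l' := α l) (r' := α r) hlr).congr_of_eventuallyEq ?_
  have hevr : ∀ᶠ t : ℝ in 𝓝 0, ∀ i, 0 < d i → a r + t * α r ≤ a i + t * α i := by
    refine Filter.eventually_all.2 fun i => ?_
    by_cases hi : 0 < d i
    · by_cases hir : i = r
      · simp [hir]
      · have hc1 : Continuous fun t : ℝ => a r + t * α r := by fun_prop
        have hc2 : Continuous fun t : ℝ => a i + t * α i := by fun_prop
        exact ((hc1.tendsto' 0 (a r) (by simp)).eventually_lt (hc2.tendsto' 0 (a i) (by simp))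
          (hr' i hi hir)).mono fun t ht _ => ht.le
    · simp [hi]
  have hevl : ∀ᶠ t : ℝ in 𝓝 0, ∀ i, d i < 0 → a i - t * α i ≤ a l - t * α l := by
    refine Filter.eventually_all.2 fun i => ?_
    by_cases hi : d i < 0
    · by_cases hil : i = l
      · simp [hil]
      · have hc1 : Continuous fun t : ℝ => a i - t * α i := by fun_prop
        have hc2 : Continuous fun t : ℝ => a l - t * α l := by fun_prop
        exact ((hc1.tendsto' 0 (a i) (by simp)).eventually_lt (hc2.tendsto' 0 (a l) (by simp))
          (hl' i hi hil)).mono fun t ht _ => ht.le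
    · simp [hi]
  filter_upwards [hevr, hevl] with t ht1 ht2
  have : slab d a α t = Icc (a l - t * α l) (a r + t * α r) := by
    ext s
    exact ⟨fun h => ⟨h.2 l hl, h.1 r hr⟩,
      fun h => ⟨fun i hi => h.2.trans (ht1 i hi), fun i hi => (ht2 i hi).trans h.1⟩⟩
  rw [this]

/-- A point present at time `t` and absent at `t'` satisfies some constraint at `t` and violates it
at `t'`; both bounds are within `|t| A` and `|t'| A` of `a i`. -/
theorem slab_diff_subset {d a α : ι → ℝ} {A : ℝ} (hα : ∀ i, |α i| ≤ A) {t t' : ℝ} :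
    slab d a α t \ slab d a α t' ⊆
      ⋃ i, Icc (a i - (|t| + |t'|) * A) (a i + (|t| + |t'|) * A) := by
  rintro s ⟨hs, hs'⟩
  have hb : ∀ r i, |r * α i| ≤ |r| * A := fun r i => by
    rw [abs_mul]
    exact mul_le_mul_of_nonneg_left (hα i) (abs_nonneg r)
  rw [slab, mem_ofPred_eq, not_and_or] at hs'
  push Not at hs'
  rcases hs' with ⟨i, hi, hlt⟩ | ⟨i, hi, hlt⟩
  · have h1 := hs.1 i hi
    have h2 := abs_le.1 (hb t i)
    have h3 := abs_le.1 (hb t' i)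
    exact mem_iUnion.2 ⟨i, by constructor <;> linarith⟩
  · have h1 := hs.2 i hi
    have h2 := abs_le.1 (hb t i)
    have h3 := abs_le.1 (hb t' i)
    exact mem_iUnion.2 ⟨i, by constructor <;> linarith⟩

theorem volume_slab_diff_le [Fintype ι] {d a α : ι → ℝ} {A : ℝ}
    (hα : ∀ i, |α i| ≤ A) {t t' : ℝ} :
    volume (slab d a α t \ slab d a α t') ≤
      ENNReal.ofReal (Fintype.card ι * (2 * ((|t| + |t'|) * A))) := by
  refine (measure_mono (slab_diff_subset hα)).trans ((measure_iUnion_fintype_le _ _).trans ?_)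
  simp only [Real.volume_Icc]
  have : ∀ i, a i + (|t| + |t'|) * A - (a i - (|t| + |t'|) * A) = 2 * ((|t| + |t'|) * A) :=
    fun i => by ring
  simp only [this, Finset.sum_const, Finset.card_univ, nsmul_eq_mul]
  rw [ENNReal.ofReal_mul (p := (Fintype.card ι : ℝ)) (by positivity), ENNReal.ofReal_natCast]

/-- This supplies the dominating function, and holds even where the `a i` coincide. The factor `4`
counts two set differences, each covered by intervals of length `2 |t| A`. -/
theorem abs_integral_slab_sub_le [Fintype ι] {d a α : ι → ℝ} {A : ℝ} (hA : 0 ≤ A)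
    (hα : ∀ i, |α i| ≤ A) {t : ℝ} {φ : ℝ → ℝ} {M : ℝ} (hM : 0 ≤ M)
    (hφt : IntegrableOn φ (slab d a α t)) (hφ0 : IntegrableOn φ (slab d a α 0))
    (hMt : ∀ s ∈ slab d a α t, |φ s| ≤ M) (hM0 : ∀ s ∈ slab d a α 0, |φ s| ≤ M) :
    |(∫ s in slab d a α t, φ s) - ∫ s in slab d a α 0, φ s| ≤
      4 * M * Fintype.card ι * A * |t| := by
  set S := slab d a α t
  set T := slab d a α 0
  have hS : MeasurableSet S := measurableSet_slab _ _ _ _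
  have hT : MeasurableSet T := measurableSet_slab _ _ _ _
  have h1 := integral_inter_add_sdiff hT hφt
  have h2 := integral_inter_add_sdiff hS hφ0
  rw [inter_comm] at h2
  have hbound : ∀ {X Y : Set ℝ}, MeasurableSet X → MeasurableSet Y → (∀ s ∈ X, |φ s| ≤ M) →
      volume (X \ Y) ≤ ENNReal.ofReal (Fintype.card ι * (2 * (|t| * A))) →
      |∫ s in X \ Y, φ s| ≤ M * (Fintype.card ι * (2 * (|t| * A))) := by
    intro X Y hX hY hXM hvol
    have hfin : volume (X \ Y) < ⊤ := hvol.trans_lt ENNReal.ofReal_lt_top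
    have := norm_setIntegral_le_of_norm_le_const (f := φ) (C := M) hfin fun s hs => hXM s hs.1
    refine this.trans (mul_le_mul_of_nonneg_left ?_ hM)
    exact ENNReal.toReal_le_of_le_ofReal (by positivity) hvol
  have h3 := volume_slab_diff_le (d := d) (a := a) hα (t := t) (t' := 0)
  have h4 := volume_slab_diff_le (d := d) (a := a) hα (t := 0) (t' := t)
  rw [abs_zero, add_zero] at h3
  rw [abs_zero, zero_add] at h4
  replace h3 := hbound hS hT hMt h3
  replace h4 := hbound hT hS hM0 h4
  rw [abs_le] at h3 h4 ⊢
  constructor <;> linarith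

end Slab

/-! ### Cutting polytopes by affine inequalities. -/

section Cut

variable {n : ℕ}

/-- In half-space form a cut only appends inequalities, and boundedness permits the return to a
finite hull. -/
theorem exists_finite_convexHull_cut {κ : Type*} [Finite κ] {Q : Set (Euc n)}
    (hQ : IsFullPolytope Q) (A : κ → Euc n →ᵃ[ℝ] ℝ) :
    ∃ V : Set (Euc n), V.Finite ∧ Q ∩ {x | ∀ k, A k x ≤ 0} = convexHull ℝ V := by
  obtain ⟨m, u, b, -, hQu⟩ := hQ.exists_description
  let a : Fin m ⊕ κ → Euc n := Sum.elim u fun k =>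
    (InnerProductSpace.toDual ℝ (Euc n)).symm (LinearMap.toContinuousLinearMap (A k).linear)
  let c : Fin m ⊕ κ → ℝ := Sum.elim b fun k => -A k 0
  have heq : Q ∩ {x | ∀ k, A k x ≤ 0} = {x | ∀ k, inner ℝ (a k) x ≤ c k} := by
    ext x
    have hA : ∀ k, inner ℝ (a (Sum.inr k)) x ≤ c (Sum.inr k) ↔ A k x ≤ 0 := fun k => by
      have : A k x = (A k).linear x + A k 0 := by
        simpa using (A k).map_vadd 0 x
      simp only [a, c, Sum.elim_inr, InnerProductSpace.toDual_symm_apply,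
        LinearMap.coe_toContinuousLinearMap']
      rw [this]
      constructor <;> intro h <;> linarith
    simp only [mem_inter_iff, mem_ofPred_eq, Sum.forall, hA]
    rw [hQu]
    rfl
  rw [heq]
  exact exists_finite_convexHull_eq_polyhedron a c
    (heq ▸ hQ.isCompact.isBounded.subset inter_subset_left)

open scoped Pointwise in
/-- The part of the cylinder over `π(P)` at heights in `[-R, R]`. -/
theorem exists_finite_convexHull_cylinder {v : Euc n} (hv : ‖v‖ = 1) {P : Set (Euc n)}
    (hP : IsFullPolytope P) {R : ℝ} (hR : 0 ≤ R) :
    ∃ V : Set (Euc n), V.Finite ∧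
      {x | proj v x ∈ proj v '' P ∧ |inner ℝ v x| ≤ R} = convexHull ℝ V := by
  obtain ⟨⟨V, hV, rfl⟩, -⟩ := hP
  -- The cylinder is the Minkowski sum of `π(P)` and the segment from `-R v` to `R v`, so sums of
  -- generating points generate it.
  refine ⟨Set.image2 (· + ·) (proj v '' V) {(-R) • v, R • v},
    (hV.image _).image2 _ (by simp), ?_⟩
  have himg : proj v '' convexHull ℝ V = convexHull ℝ (proj v '' V) :=
    LinearMap.image_convexHull ((ℝ ∙ v)ᗮ.starProjection : Euc n →ₗ[ℝ] Euc n) V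
  rw [Set.image2_add, convexHull_add, convexHull_pair, ← himg]
  have hvv : inner ℝ v v = (1 : ℝ) := by rw [real_inner_self_eq_norm_sq, hv, one_pow]
  have hseg : segment ℝ ((-R) • v) (R • v) = (fun s : ℝ => s • v) '' Icc (-R) R := by
    rw [← segment_eq_Icc (by linarith)]
    exact (image_segment ℝ ((LinearMap.toSpanSingleton ℝ (Euc n) v).toAffineMap) (-R) R).symm
  rw [hseg]
  ext x
  simp only [mem_ofPred_eq, abs_le]
  constructor
  · rintro ⟨hx, hxR⟩
    exact Set.mem_add.2 ⟨_, hx, _, ⟨_, hxR, rfl⟩, proj_add_inner_smul hv x⟩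
  · intro hx
    obtain ⟨_, ⟨z, hz, rfl⟩, _, ⟨s, hs, rfl⟩, rfl⟩ := Set.mem_add.1 hx
    have h1 := proj_coe_add_smul (v := v) ⟨proj v z, proj_mem z⟩ s
    have h2 := inner_coe_add_smul hv ⟨proj v z, proj_mem z⟩ s
    simp only at h1 h2 ⊢
    rw [h1, h2]
    exact ⟨⟨z, hz, rfl⟩, hs⟩

end Cut

/-! ### The moved sets are polytopes, of full dimension for small times. -/

section Moved

variable {n m : ℕ} {P : Set (Euc n)} {f : Euc n → ℝ} {u : Fin m → Euc n} {b : Fin m → ℝ}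
  {v : Euc n}

/-- The canonical extension of the restriction of `f` to the relative interior of a facet. -/
noncomputable def facetExtension (P : Set (Euc n)) (f : Euc n → ℝ) (w : Euc n) (c : ℝ) :
    Euc n → ℝ :=
  canonicalExtension (intrinsicInterior ℝ (facetOf P w c)) f

theorem IsIrredundantDescription.exists_facetExtension_eq_minOf
    (h : IsIrredundantDescription P u b) (hP : (interior P).Nonempty)
    (hf : ∀ F ∈ facets P, IsPiecewiseAffineConcaveOn (intrinsicInterior ℝ F) f) (i : Fin m) :
    ∃ (H : Finset (Euc n →ᵃ[ℝ] ℝ)) (hH : H.Nonempty),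
      facetExtension P f (u i) (b i) = minOf H hH ∧
      ∀ x ∈ intrinsicInterior ℝ (facetOf P (u i) (b i)),
        f x = facetExtension P f (u i) (b i) x := by
  obtain ⟨z, hz, hz'⟩ := h.exists_mem_hyperplane_lt hP i
  exact exists_canonicalExtension_eq_minOf ⟨z, h.mem_intrinsicInterior hz hz'⟩
    (hf _ (h.facetOf_mem_facets hP i))

/-- Multiplication by `⟨u i, v⟩` gives upper and lower constraints the same form: the sign reversed
for lower ones is compensated by the absolute value in `velocity`. -/
theorem mem_movedPolytope_iff (hv : IsGeneric u v) {t : ℝ} {x : Euc n} :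
    x ∈ movedPolytope P f u b v t ↔ proj v x ∈ proj v '' P ∧
      ∀ i, inner ℝ (u i) x ≤
        b i + t * facetExtension P f (u i) (b i) (lift v (u i) (b i) (proj v x)) := by
  have hinner : ∀ i, inner ℝ (u i) x =
      inner ℝ (u i) (proj v x) + inner ℝ v x * inner ℝ (u i) v := fun i => by
    conv_lhs => rw [← proj_add_inner_smul hv.1 x]
    rw [inner_add_right, inner_smul_right]
  have hpos : ∀ i, 0 < inner ℝ (u i) v →
      (inner ℝ v x ≤ height v (u i) (b i) x + t * velocity P f v (u i) (b i) (proj v x) ↔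
        inner ℝ (u i) x ≤
          b i + t * facetExtension P f (u i) (b i) (lift v (u i) (b i) (proj v x))) :=
    fun i hi => by
      rw [hinner, height, velocity, abs_of_pos hi, mul_div_assoc', ← add_div, le_div_iff₀ hi,
        facetExtension]
      constructor <;> intro h <;> linarith
  have hneg : ∀ i, inner ℝ (u i) v < 0 →
      (height v (u i) (b i) x - t * velocity P f v (u i) (b i) (proj v x) ≤ inner ℝ v x ↔
        inner ℝ (u i) x ≤
          b i + t * facetExtension P f (u i) (b i) (lift v (u i) (b i) (proj v x))) :=
    fun i hi => by
      rw [hinner, height, velocity, abs_of_neg hi, div_neg, mul_neg, sub_neg_eq_add,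
        mul_div_assoc', ← add_div, div_le_iff_of_neg hi, facetExtension]
      constructor <;> intro h <;> linarith
  constructor
  · rintro ⟨h0, h1, h2⟩
    refine ⟨h0, fun i => ?_⟩
    rcases (hv.2 i).lt_or_gt with hi | hi
    · exact (hneg i hi).1 (h2 i hi)
    · exact (hpos i hi).1 (h1 i hi)
  · rintro ⟨h0, h1⟩
    exact ⟨h0, fun i hi => (hpos i hi).2 (h1 i), fun i hi => (hneg i hi).2 (h1 i)⟩

theorem coe_add_smul_mem_movedPolytope_iff (hv : ‖v‖ = 1) {t : ℝ} (y : (ℝ ∙ v)ᗮ) (s : ℝ) :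
    (y : Euc n) + s • v ∈ movedPolytope P f u b v t ↔ (y : Euc n) ∈ proj v '' P ∧
      s ∈ slab (fun i => inner ℝ (u i) v) (fun i => height v (u i) (b i) (y : Euc n))
        (fun i => velocity P f v (u i) (b i) (y : Euc n)) t := by
  simp only [movedPolytope, slab, mem_ofPred_eq, proj_coe_add_smul, inner_coe_add_smul hv,
    height_coe_add_smul]

theorem movedPolytope_zero (h : IsIrredundantDescription P u b) (hv : IsGeneric u v) :
    movedPolytope P f u b v 0 = P := by
  ext x
  rw [mem_movedPolytope_iff hv, h.mem_iff]
  simp only [zero_mul, add_zero, and_iff_right_iff_imp]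
  exact fun hx => ⟨x, h.mem_iff.2 hx, rfl⟩

theorem polytopeFamily_zero (h : IsIrredundantDescription P u b) (hv : IsGeneric u v) :
    polytopeFamily P f u b v 0 = P := by
  rw [polytopeFamily, movedPolytope_zero h hv, ite_self]

/-- Otherwise `P` would contain a ray in direction `v`. Applied to `v` and `-v`, this makes every
fibre bounded above and below. -/
theorem exists_inner_pos_of_isBounded (h : IsIrredundantDescription P u b) (hP : P.Nonempty)
    (hb : Bornology.IsBounded P) {v : Euc n} (hv : v ≠ 0) : ∃ i, 0 < inner ℝ (u i) v := by
  by_contra! hcon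
  obtain ⟨p, hp⟩ := hP
  obtain ⟨C, hC⟩ := isBounded_iff_forall_norm_le.1 hb
  have hmem : ∀ s : ℝ, 0 ≤ s → p + s • v ∈ P := fun s hs => h.mem_iff.2 fun i => by
    rw [inner_add_right, inner_smul_right]
    nlinarith [h.mem_iff.1 hp i, hcon i]
  have hvn : 0 < ‖v‖ := norm_pos_iff.2 hv
  have hC0 : 0 ≤ C := (norm_nonneg p).trans (hC p hp)
  -- A displacement of length `2 * C + 1` exceeds the largest distance `2 * C` allowed between
  -- points of norm at most `C`.
  have h1 := hC _ (hmem ((2 * C + 1) / ‖v‖) (by positivity))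
  have h2 : ‖((2 * C + 1) / ‖v‖) • v‖ = 2 * C + 1 := by
    rw [norm_smul, Real.norm_eq_abs, abs_of_nonneg (by positivity), div_mul_cancel₀ _ hvn.ne']
  have h3 := norm_sub_le (p + ((2 * C + 1) / ‖v‖) • v) p
  rw [add_sub_cancel_left, h2] at h3
  linarith [hC p hp]

theorem continuous_facetExtension (h : IsIrredundantDescription P u b)
    (hP : (interior P).Nonempty)
    (hf : ∀ F ∈ facets P, IsPiecewiseAffineConcaveOn (intrinsicInterior ℝ F) f) (i : Fin m) :
    Continuous (facetExtension P f (u i) (b i)) := by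
  obtain ⟨H, hH, heq, -⟩ := h.exists_facetExtension_eq_minOf hP hf i
  rw [heq]
  exact continuous_minOf H hH

theorem continuous_velocity (h : IsIrredundantDescription P u b)
    (hP : (interior P).Nonempty)
    (hf : ∀ F ∈ facets P, IsPiecewiseAffineConcaveOn (intrinsicInterior ℝ F) f) (i : Fin m) :
    Continuous (velocity P f v (u i) (b i)) :=
  ((continuous_facetExtension h hP hf i).comp (continuous_lift _ _)).div_const _

theorem exists_bound_height_velocity (h : IsIrredundantDescription P u b)
    (hP : IsFullPolytope P)
    (hf : ∀ F ∈ facets P, IsPiecewiseAffineConcaveOn (intrinsicInterior ℝ F) f) (v : Euc n) :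
    ∃ C, 0 ≤ C ∧ ∀ y ∈ proj v '' P, ∀ i, |height v (u i) (b i) y| ≤ C ∧
      |velocity P f v (u i) (b i) y| ≤ C := by
  have hK : IsCompact (proj v '' P) := hP.isCompact.image continuous_proj
  have hc : Continuous fun y : Euc n => fun i : Fin m =>
      (height v (u i) (b i) y, velocity P f v (u i) (b i) y) :=
    continuous_pi fun i => (continuous_height _ _).prodMk (continuous_velocity h hP.2 hf i)
  obtain ⟨C, hC⟩ := hK.exists_bound_of_continuousOn hc.continuousOn
  obtain ⟨p, hp⟩ := hP.nonempty
  refine ⟨C, (norm_nonneg _).trans (hC _ ⟨p, hp, rfl⟩), fun y hy i => ?_⟩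
  have h1 := (norm_le_pi_norm _ i).trans (hC y hy)
  exact ⟨(norm_fst_le _).trans h1, (norm_snd_le _).trans h1⟩

theorem exists_bound_movedPolytope (h : IsIrredundantDescription P u b)
    (hP : IsFullPolytope P)
    (hf : ∀ F ∈ facets P, IsPiecewiseAffineConcaveOn (intrinsicInterior ℝ F) f)
    (hv : IsGeneric u v) :
    ∃ R, 0 ≤ R ∧ ∀ t ∈ Icc (0 : ℝ) 1, movedPolytope P f u b v t ⊆
      {x | proj v x ∈ proj v '' P ∧ |inner ℝ v x| ≤ R} := by
  have hv0 : v ≠ 0 := by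
    rintro rfl
    simpa using hv.1
  obtain ⟨C, hC0, hC⟩ := exists_bound_height_velocity h hP hf v
  obtain ⟨i, hi⟩ := exists_inner_pos_of_isBounded h hP.nonempty hP.isCompact.isBounded hv0
  obtain ⟨j, hj⟩ := exists_inner_pos_of_isBounded h hP.nonempty hP.isCompact.isBounded
    (neg_ne_zero.2 hv0)
  rw [inner_neg_right, neg_pos] at hj
  -- One `C` bounds the height; the other bounds `t` times the velocity, as `t ≤ 1`.
  refine ⟨2 * C, by positivity, fun t ht x hx => ⟨hx.1, ?_⟩⟩
  have hheight : ∀ k, height v (u k) (b k) x = height v (u k) (b k) (proj v x) := fun k => by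
    rw [height, height, proj_proj]
  have h1 := hx.2.1 i hi
  have h2 := hx.2.2 j hj
  rw [hheight] at h1 h2
  obtain ⟨h3, h4⟩ := hC _ hx.1 i
  obtain ⟨h5, h6⟩ := hC _ hx.1 j
  rw [abs_le] at *
  obtain ⟨ht0, ht1⟩ := ht
  constructor <;> nlinarith

theorem isFullPolytope_movedPolytope (h : IsIrredundantDescription P u b)
    (hP : IsFullPolytope P)
    (hf : ∀ F ∈ facets P, IsPiecewiseAffineConcaveOn (intrinsicInterior ℝ F) f)
    (hv : IsGeneric u v) {t : ℝ} (ht : t ∈ Icc (0 : ℝ) 1)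
    (hint : (interior (movedPolytope P f u b v t)).Nonempty) :
    IsFullPolytope (movedPolytope P f u b v t) := by
  refine ⟨?_, hint⟩
  obtain ⟨R, hR0, hR⟩ := exists_bound_movedPolytope h hP hf hv
  -- `Q` is full-dimensional because it contains the moved polytope, whose interior is nonempty by
  -- hypothesis.
  set Q : Set (Euc n) := {x | proj v x ∈ proj v '' P ∧ |inner ℝ v x| ≤ R}
  have hQ : IsFullPolytope Q :=
    ⟨exists_finite_convexHull_cylinder hv.1 hP hR0, hint.mono (interior_mono (hR t ht))⟩
  choose H hH hext _ using h.exists_facetExtension_eq_minOf hP.2 hf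
  let π : Euc n →ₗ[ℝ] Euc n := (ℝ ∙ v)ᗮ.starProjection
  let hgt : Fin m → Euc n →ᵃ[ℝ] ℝ := fun i =>
    ((inner ℝ (u i) v)⁻¹ • -(innerₗ (Euc n) (u i) ∘ₗ π)).toAffineMap +
      AffineMap.const ℝ _ (b i / inner ℝ (u i) v)
  let lft : Fin m → Euc n →ᵃ[ℝ] Euc n := fun i =>
    π.toAffineMap + (LinearMap.toSpanSingleton ℝ (Euc n) v).toAffineMap.comp (hgt i)
  have hlft : ∀ i x, lft i x = lift v (u i) (b i) (proj v x) := fun i x => by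
    have h1 : hgt i x = height v (u i) (b i) (proj v x) := by
      rw [height, proj_proj]
      simp only [hgt, π, proj, AffineMap.coe_add, LinearMap.coe_toAffineMap, Pi.add_apply,
        LinearMap.smul_apply, LinearMap.neg_apply, LinearMap.comp_apply, innerₗ_apply_apply,
        AffineMap.const_apply, ContinuousLinearMap.coe_coe, smul_eq_mul]
      ring
    rw [lift, ← h1]
    simp only [lft, π, proj, AffineMap.coe_add, LinearMap.coe_toAffineMap, Pi.add_apply,
      AffineMap.comp_apply, LinearMap.toSpanSingleton_apply, ContinuousLinearMap.coe_coe]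
  -- There is one affine inequality for each facet and each member of its family of affine
  -- functionals.
  let A : (Σ i, H i) → Euc n →ᵃ[ℝ] ℝ := fun k =>
    (innerₗ (Euc n) (u k.1)).toAffineMap - AffineMap.const ℝ _ (b k.1) -
      t • (k.2 : Euc n →ᵃ[ℝ] ℝ).comp (lft k.1)
  have hA : ∀ i (g : H i) x, A ⟨i, g⟩ x ≤ 0 ↔ inner ℝ (u i) x ≤
      b i + t * (g : Euc n →ᵃ[ℝ] ℝ) (lift v (u i) (b i) (proj v x)) := fun i g x => by
    simp only [A, AffineMap.coe_sub, AffineMap.coe_smul, Pi.sub_apply, Pi.smul_apply,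
      LinearMap.coe_toAffineMap, innerₗ_apply_apply, AffineMap.const_apply, AffineMap.comp_apply,
      hlft, smul_eq_mul]
    constructor <;> intro h <;> linarith
  have heq : movedPolytope P f u b v t = Q ∩ {x | ∀ k, A k x ≤ 0} := by
    have hiff : ∀ x, x ∈ movedPolytope P f u b v t ↔
        proj v x ∈ proj v '' P ∧ ∀ k, A k x ≤ 0 := fun x => by
      rw [mem_movedPolytope_iff hv]
      simp only [Sigma.forall, hA, hext]
      -- As `t ≥ 0`, a bound by `t` times the minimum is equivalent to the bounds by `t` times each
      -- member.
      refine and_congr_right fun _ => forall_congr' fun i => ⟨fun hx g => hx.trans ?_,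
        fun hx => ?_⟩
      · have := Finset.inf'_le (s := H i)
          (fun h => h (lift v (u i) (b i) (proj v x))) g.2
        exact add_le_add_right (mul_le_mul_of_nonneg_left this ht.1) _
      · obtain ⟨g, hg, hmin⟩ := Finset.exists_mem_eq_inf' (hH i)
          fun h => h (lift v (u i) (b i) (proj v x))
        rw [minOf, hmin]
        exact hx ⟨g, hg⟩
    ext x
    rw [hiff]
    exact ⟨fun hx => ⟨hR t ht ((hiff x).2 hx), hx.2⟩, fun hx => ⟨hx.1.1, hx.2⟩⟩
  rw [heq]
  exact exists_finite_convexHull_cut hQ A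

theorem isFullPolytope_polytopeFamily (h : IsIrredundantDescription P u b)
    (hP : IsFullPolytope P)
    (hf : ∀ F ∈ facets P, IsPiecewiseAffineConcaveOn (intrinsicInterior ℝ F) f)
    (hv : IsGeneric u v) {t : ℝ} (ht : t ∈ Icc (0 : ℝ) 1) :
    IsFullPolytope (polytopeFamily P f u b v t) := by
  rw [polytopeFamily]
  split_ifs with hint
  · exact isFullPolytope_movedPolytope h hP hf hv ht hint
  · exact hP

theorem eventually_interior_movedPolytope_nonempty (h : IsIrredundantDescription P u b)
    (hP : IsFullPolytope P)
    (hf : ∀ F ∈ facets P, IsPiecewiseAffineConcaveOn (intrinsicInterior ℝ F) f)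
    (hv : IsGeneric u v) :
    ∀ᶠ t in 𝓝 (0 : ℝ), (interior (movedPolytope P f u b v t)).Nonempty := by
  obtain ⟨p, hp⟩ := hP.2
  have hev : ∀ᶠ q : ℝ × Euc n in 𝓝 0 ×ˢ 𝓝 p, ∀ i, inner ℝ (u i) q.2 <
      b i + q.1 * facetExtension P f (u i) (b i) (lift v (u i) (b i) (proj v q.2)) := by
    rw [← nhds_prod_eq]
    refine Filter.eventually_all.2 fun i => ?_
    have hc := (continuous_facetExtension h hP.2 hf i).comp
      ((continuous_lift (v := v) (u i) (b i)).comp (continuous_proj (v := v)))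
    have hc1 : Continuous fun q : ℝ × Euc n => inner ℝ (u i) q.2 := by fun_prop
    have hc2 : Continuous fun q : ℝ × Euc n => b i + q.1 *
        facetExtension P f (u i) (b i) (lift v (u i) (b i) (proj v q.2)) :=
      continuous_const.add (continuous_fst.mul (hc.comp continuous_snd))
    refine hc1.continuousAt.eventually_lt hc2.continuousAt ?_
    simpa using h.mem_interior_iff.1 hp i
  -- The strict inequalities are open jointly in time and position, so at each small `t` they hold
  -- in a whole neighbourhood of `p`.
  filter_upwards [hev.curry] with t ht
  refine ⟨p, mem_interior_iff_mem_nhds.2 ?_⟩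
  filter_upwards [ht, isOpen_interior.mem_nhds hp] with x hx hxP
  exact (mem_movedPolytope_iff hv).2 ⟨⟨x, interior_subset hxP, rfl⟩, fun i => (hx i).le⟩

theorem eventually_polytopeFamily_eq (h : IsIrredundantDescription P u b)
    (hP : IsFullPolytope P)
    (hf : ∀ F ∈ facets P, IsPiecewiseAffineConcaveOn (intrinsicInterior ℝ F) f)
    (hv : IsGeneric u v) :
    ∀ᶠ t in 𝓝 (0 : ℝ), polytopeFamily P f u b v t = movedPolytope P f u b v t :=
  (eventually_interior_movedPolytope_nonempty h hP hf hv).mono fun _ ht => if_pos ht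

end Moved

/-! ### Integration of the fibre derivatives. -/

section WeakDerivative

variable {n m : ℕ} {P : Set (Euc n)} {f : Euc n → ℝ} {u : Fin m → Euc n} {b : Fin m → ℝ}
  {v : Euc n}

theorem isClosed_movedPolytope (h : IsIrredundantDescription P u b) (hP : IsFullPolytope P)
    (hf : ∀ F ∈ facets P, IsPiecewiseAffineConcaveOn (intrinsicInterior ℝ F) f)
    (hv : IsGeneric u v) (t : ℝ) : IsClosed (movedPolytope P f u b v t) := by
  have heq : movedPolytope P f u b v t = proj v ⁻¹' (proj v '' P) ∩ ⋂ i, {x | inner ℝ (u i) x ≤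
      b i + t * facetExtension P f (u i) (b i) (lift v (u i) (b i) (proj v x))} := by
    ext x
    rw [mem_movedPolytope_iff hv]
    simp
  rw [heq]
  refine ((hP.isCompact.image continuous_proj).isClosed.preimage continuous_proj).inter
    (isClosed_iInter fun i => isClosed_le (by fun_prop) (continuous_const.add
      (continuous_const.mul ((continuous_facetExtension h hP.2 hf i).comp
        ((continuous_lift (u i) (b i)).comp continuous_proj)))))

theorem isCompact_cylinder (hv : ‖v‖ = 1) (hP : IsFullPolytope P) {R : ℝ} (hR : 0 ≤ R) :
    IsCompact {x | proj v x ∈ proj v '' P ∧ |inner ℝ v x| ≤ R} := by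
  obtain ⟨V, hV, heq⟩ := exists_finite_convexHull_cylinder hv hP hR
  exact heq ▸ hV.isCompact_convexHull (𝕜 := ℝ)

theorem isCompact_movedPolytope (h : IsIrredundantDescription P u b) (hP : IsFullPolytope P)
    (hf : ∀ F ∈ facets P, IsPiecewiseAffineConcaveOn (intrinsicInterior ℝ F) f)
    (hv : IsGeneric u v) {t : ℝ} (ht : t ∈ Icc (0 : ℝ) 1) :
    IsCompact (movedPolytope P f u b v t) := by
  obtain ⟨R, hR0, hR⟩ := exists_bound_movedPolytope h hP hf hv
  exact (isCompact_cylinder hv.1 hP hR0).of_isClosed_subset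
    (isClosed_movedPolytope h hP hf hv t) (hR t ht)

theorem isCompact_preimage_proj_image (hP : IsFullPolytope P) :
    IsCompact {y : (ℝ ∙ v)ᗮ | (y : Euc n) ∈ proj v '' P} :=
  ((ℝ ∙ v)ᗮ.closed_of_finiteDimensional.isClosedEmbedding_subtypeVal).isCompact_preimage
    (hP.isCompact.image continuous_proj)

theorem proj_lift_coe (w : Euc n) (c : ℝ) (y : (ℝ ∙ v)ᗮ) :
    proj v (lift v w c (y : Euc n)) = y :=
  proj_coe_add_smul y _

theorem isCompact_preimage_lift (hP : IsFullPolytope P) (w : Euc n) (c : ℝ) :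
    IsCompact ((fun y : (ℝ ∙ v)ᗮ => lift v w c (y : Euc n)) ⁻¹' P) :=
  (isCompact_preimage_proj_image hP).of_isClosed_subset
    (hP.isCompact.isClosed.preimage ((continuous_lift w c).comp continuous_subtype_val))
    fun y hy => ⟨_, hy, proj_lift_coe w c y⟩

/-- Integration over a compact set along the lines parallel to `v`. -/
theorem integrable_indicator_comp_coe_add_smul (hv : ‖v‖ = 1) {K : Set (Euc n)} (hK : IsCompact K)
    {g : Euc n → ℝ} (hg : Continuous g) :
    Integrable fun p : (ℝ ∙ v)ᗮ × ℝ => K.indicator g ((p.1 : Euc n) + p.2 • v) := by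
  have h1 : Integrable (K.indicator g) :=
    (hg.continuousOn.integrableOn_compact hK).integrable_indicator hK.measurableSet
  exact ((measurePreserving_coe_add_smul hv).integrable_comp_emb
    (measurableEmbedding_coe_add_smul hv)).2 h1

theorem setIntegral_eq_integral_integral_coe_add_smul (hv : ‖v‖ = 1) {K : Set (Euc n)}
    (hK : IsCompact K) {g : Euc n → ℝ} (hg : Continuous g) :
    ∫ x in K, g x = ∫ y : (ℝ ∙ v)ᗮ, ∫ s : ℝ, K.indicator g ((y : Euc n) + s • v) := by
  rw [← integral_indicator hK.measurableSet,
    ← (measurePreserving_coe_add_smul hv).integral_comp (measurableEmbedding_coe_add_smul hv)]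
  exact integral_prod _ (integrable_indicator_comp_coe_add_smul hv hK hg)

theorem integral_indicator_movedPolytope (hv : ‖v‖ = 1) {t : ℝ} {g : Euc n → ℝ} (y : (ℝ ∙ v)ᗮ)
    (hy : (y : Euc n) ∈ proj v '' P) :
    ∫ s : ℝ, (movedPolytope P f u b v t).indicator g ((y : Euc n) + s • v) =
      ∫ s in slab (fun i => inner ℝ (u i) v) (fun i => height v (u i) (b i) (y : Euc n))
        (fun i => velocity P f v (u i) (b i) (y : Euc n)) t, g ((y : Euc n) + s • v) := by
  rw [← integral_indicator (measurableSet_slab _ _ _ _)]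
  congr 1
  ext s
  by_cases hs : (y : Euc n) + s • v ∈ movedPolytope P f u b v t
  · rw [indicator_of_mem hs,
      indicator_of_mem ((coe_add_smul_mem_movedPolytope_iff hv y s).1 hs).2]
  · rw [indicator_of_notMem hs, indicator_of_notMem
      fun hs' => hs ((coe_add_smul_mem_movedPolytope_iff hv y s).2 ⟨hy, hs'⟩)]

theorem integral_indicator_movedPolytope_of_notMem (hv : ‖v‖ = 1) {t : ℝ} {g : Euc n → ℝ}
    (y : (ℝ ∙ v)ᗮ) (hy : (y : Euc n) ∉ proj v '' P) :
    ∫ s : ℝ, (movedPolytope P f u b v t).indicator g ((y : Euc n) + s • v) = 0 := by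
  have : ∀ s : ℝ, (movedPolytope P f u b v t).indicator g ((y : Euc n) + s • v) = 0 := fun s =>
    indicator_of_notMem
      (fun hs => hy ((coe_add_smul_mem_movedPolytope_iff hv y s).1 hs).1) g
  simp [this]

theorem hasDerivAt_integral_indicator_movedPolytope (h : IsIrredundantDescription P u b)
    (hP : IsFullPolytope P) (hv : IsGeneric u v) {g : Euc n → ℝ} (hg : Continuous g)
    {y : (ℝ ∙ v)ᗮ} (hy : Function.Injective fun i => height v (u i) (b i) (y : Euc n)) :
    HasDerivAt
      (fun t : ℝ => ∫ s : ℝ, (movedPolytope P f u b v t).indicator g ((y : Euc n) + s • v))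
      (∑ i, P.indicator g (lift v (u i) (b i) (y : Euc n)) * velocity P f v (u i) (b i) y) 0 := by
  have hv0 : v ≠ 0 := by
    rintro rfl
    simpa using hv.1
  by_cases hyP : (y : Euc n) ∈ proj v '' P
  · simp only [integral_indicator_movedPolytope hv.1 y hyP]
    have hpos := exists_inner_pos_of_isBounded h hP.nonempty hP.isCompact.isBounded hv0
    have hneg := exists_inner_pos_of_isBounded h hP.nonempty hP.isCompact.isBounded
      (neg_ne_zero.2 hv0)
    simp only [inner_neg_right, neg_pos] at hneg
    have hne : (slab (fun i => inner ℝ (u i) v) (fun i => height v (u i) (b i) (y : Euc n))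
        (fun i => velocity P f v (u i) (b i) (y : Euc n)) 0).Nonempty := by
      obtain ⟨p, hp, hpy⟩ := hyP
      refine ⟨inner ℝ v p, ((coe_add_smul_mem_movedPolytope_iff hv.1 y _).1 ?_).2⟩
      rw [movedPolytope_zero h hv, ← hpy, proj_add_inner_smul hv.1]
      exact hp
    have hmain := hasDerivAt_integral_slab hv.2 hpos hneg hy hne
      (φ := fun s => g ((y : Euc n) + s • v)) (by fun_prop)
    refine hmain.congr_deriv (Finset.sum_congr rfl fun i _ => ?_)
    congr 1
    -- At time `0` the slab is the fibre of `P`, so its indicator at a height equals the indicator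
    -- of `P` at the lifted point.
    have hiff := coe_add_smul_mem_movedPolytope_iff (P := P) (f := f) (u := u) (b := b) hv.1
      (t := 0) y (height v (u i) (b i) (y : Euc n))
    rw [movedPolytope_zero h hv, ← lift] at hiff
    by_cases hi : lift v (u i) (b i) (y : Euc n) ∈ P
    · rw [indicator_of_mem hi, indicator_of_mem (hiff.1 hi).2, lift]
    · rw [indicator_of_notMem hi, indicator_of_notMem fun hs => hi (hiff.2 ⟨hyP, hs⟩)]
  · simp only [integral_indicator_movedPolytope_of_notMem hv.1 y hyP]
    have : ∀ i, P.indicator g (lift v (u i) (b i) (y : Euc n)) = 0 := fun i =>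
      indicator_of_notMem (fun hs => hyP ⟨_, hs, proj_lift_coe _ _ y⟩) g
    simp only [this, zero_mul, Finset.sum_const_zero]
    exact hasDerivAt_const _ _

/-- A facet point on a second bounding hyperplane projects to a `y` with two equal heights, which is
excluded almost everywhere. -/
theorem IsIrredundantDescription.ae_lift_mem_intrinsicInterior
    (h : IsIrredundantDescription P u b) (hP : (interior P).Nonempty) (hv : IsGeneric u v)
    (i : Fin m) :
    ∀ᵐ y : (ℝ ∙ v)ᗮ, lift v (u i) (b i) (y : Euc n) ∈ facetOf P (u i) (b i) →
      lift v (u i) (b i) (y : Euc n) ∈ intrinsicInterior ℝ (facetOf P (u i) (b i)) := by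
  filter_upwards [h.ae_height_injective hP hv] with y hy hyF
  refine h.mem_intrinsicInterior hyF.2 fun j hj =>
    lt_of_le_of_ne (h.mem_iff.1 hyF.1 j) fun heq => hj (hy ?_)
  exact ((inner_coe_add_smul_eq_iff (hv.2 j) (b j) y _).1 heq).symm

theorem IsFullPolytope.measurableSet_facetOf (hP : IsFullPolytope P) (w : Euc n)
    (c : ℝ) : MeasurableSet (facetOf P w c) :=
  (hP.isCompact.isClosed.inter (isClosed_eq (f := fun x => inner ℝ w x) (by fun_prop)
    continuous_const)).measurableSet

theorem IsIrredundantDescription.affDim_facetOf_eq (h : IsIrredundantDescription P u b)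
    (hP : (interior P).Nonempty) (hv : ‖v‖ = 1) (i : Fin m) :
    affDim (facetOf P (u i) (b i)) = Module.finrank ℝ (ℝ ∙ v)ᗮ := by
  rw [h.affDim_facetOf hP]
  have h1 := finrank_orthogonal_unit_add_one (h.norm_eq i)
  have h2 := finrank_orthogonal_unit_add_one hv
  omega

/-- The values of `f` are prescribed only on relative interiors; the rest of the facet is null. -/
theorem IsIrredundantDescription.ae_facetExtension_eq (h : IsIrredundantDescription P u b)
    (hP : IsFullPolytope P)
    (hf : ∀ F ∈ facets P, IsPiecewiseAffineConcaveOn (intrinsicInterior ℝ F) f)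
    (hv : IsGeneric u v) (i : Fin m) :
    ∀ᵐ x ∂(relVolume (facetOf P (u i) (b i))), facetExtension P f (u i) (b i) x = f x := by
  obtain ⟨H, hH, -, heq⟩ := h.exists_facetExtension_eq_minOf hP.2 hf i
  refine ae_relVolume_of_ae hv.1 (h.norm_eq i) (hv.2 i)
    (hP.measurableSet_facetOf _ _) (fun x hx => hx.2)
    (h.affDim_facetOf_eq hP.2 hv.1 i) ?_
  filter_upwards [h.ae_lift_mem_intrinsicInterior hP.2 hv i] with y hy hyF
  exact (heq _ (hy hyF)).symm

/-- The denominator in `velocity` is the Jacobian of the lift, so a flux through `v^⊥` becomes an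
integral against facet volume. -/
theorem integral_indicator_mul_velocity (h : IsIrredundantDescription P u b)
    (hP : IsFullPolytope P)
    (hf : ∀ F ∈ facets P, IsPiecewiseAffineConcaveOn (intrinsicInterior ℝ F) f)
    (hv : IsGeneric u v) (g : Euc n → ℝ) (i : Fin m) :
    ∫ y : (ℝ ∙ v)ᗮ, P.indicator g (lift v (u i) (b i) (y : Euc n)) *
        velocity P f v (u i) (b i) (y : Euc n) =
      ∫ x, g x * f x ∂(relVolume (facetOf P (u i) (b i))) := by
  have hF := hP.measurableSet_facetOf (u i) (b i)
  have hae : ∫ x, g x * f x ∂(relVolume (facetOf P (u i) (b i))) =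
      ∫ x, g x * facetExtension P f (u i) (b i) x ∂(relVolume (facetOf P (u i) (b i))) := by
    refine integral_congr_ae ?_
    filter_upwards [h.ae_facetExtension_eq hP hf hv i] with x hx
    rw [hx]
  rw [hae, integral_relVolume hv.1 (h.norm_eq i) (hv.2 i) hF (fun x hx => hx.2)
    (h.affDim_facetOf_eq hP.2 hv.1 i), ← integral_indicator
    ((measurableEmbedding_lift _ _).measurable hF), ← integral_const_mul]
  congr 1
  ext y
  by_cases hy : lift v (u i) (b i) (y : Euc n) ∈ P
  · rw [indicator_of_mem hy, indicator_of_mem (show y ∈ (fun y : (ℝ ∙ v)ᗮ =>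
      lift v (u i) (b i) (y : Euc n)) ⁻¹' facetOf P (u i) (b i) from
        ⟨hy, inner_lift_coe (hv.2 i) _ y⟩), velocity, facetExtension]
    ring
  · rw [indicator_of_notMem hy, indicator_of_notMem fun hy' => hy hy'.1]
    ring

theorem integrable_indicator_mul_velocity (h : IsIrredundantDescription P u b)
    (hP : IsFullPolytope P)
    (hf : ∀ F ∈ facets P, IsPiecewiseAffineConcaveOn (intrinsicInterior ℝ F) f)
    {g : Euc n → ℝ} (hg : Continuous g) (i : Fin m) :
    Integrable fun y : (ℝ ∙ v)ᗮ => P.indicator g (lift v (u i) (b i) (y : Euc n)) *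
        velocity P f v (u i) (b i) (y : Euc n) := by
  have hK := isCompact_preimage_lift (v := v) hP (u i) (b i)
  have hc : Continuous fun y : (ℝ ∙ v)ᗮ => g (lift v (u i) (b i) (y : Euc n)) *
      velocity P f v (u i) (b i) (y : Euc n) :=
    (hg.comp ((continuous_lift _ _).comp continuous_subtype_val)).mul
      ((continuous_velocity h hP.2 hf i).comp continuous_subtype_val)
  refine ((hc.continuousOn.integrableOn_compact hK).integrable_indicator
    hK.measurableSet).congr (Filter.Eventually.of_forall fun y => ?_)
  by_cases hy : lift v (u i) (b i) (y : Euc n) ∈ P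
  · simp [indicator, hy]
  · simp [indicator, hy]

theorem exists_bound_integral_indicator_movedPolytope_sub (h : IsIrredundantDescription P u b)
    (hP : IsFullPolytope P)
    (hf : ∀ F ∈ facets P, IsPiecewiseAffineConcaveOn (intrinsicInterior ℝ F) f)
    (hv : IsGeneric u v) {g : Euc n → ℝ} (hg : Continuous g) :
    ∃ B, ∀ t ∈ Icc (0 : ℝ) 1, ∀ y : (ℝ ∙ v)ᗮ,
      |(∫ s : ℝ, (movedPolytope P f u b v t).indicator g ((y : Euc n) + s • v)) -
        ∫ s : ℝ, (movedPolytope P f u b v 0).indicator g ((y : Euc n) + s • v)| ≤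
      {y : (ℝ ∙ v)ᗮ | (y : Euc n) ∈ proj v '' P}.indicator (fun _ => B) y * t := by
  obtain ⟨R, hR0, hR⟩ := exists_bound_movedPolytope h hP hf hv
  obtain ⟨C, hC0, hC⟩ := exists_bound_height_velocity h hP hf v
  obtain ⟨M, hM⟩ := (isCompact_cylinder hv.1 hP hR0).exists_bound_of_continuousOn hg.continuousOn
  have hM0 : 0 ≤ M := by
    obtain ⟨p, hp⟩ := hP.nonempty
    refine (norm_nonneg _).trans (hM p (hR 0 ⟨le_rfl, zero_le_one⟩ ?_))
    rwa [movedPolytope_zero h hv]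
  refine ⟨4 * M * Fintype.card (Fin m) * C, fun t ht y => ?_⟩
  by_cases hy : (y : Euc n) ∈ proj v '' P
  · have hmem : ∀ t' ∈ Icc (0 : ℝ) 1, ∀ s ∈ slab (fun i => inner ℝ (u i) v)
        (fun i => height v (u i) (b i) (y : Euc n))
        (fun i => velocity P f v (u i) (b i) (y : Euc n)) t',
        |g ((y : Euc n) + s • v)| ≤ M ∧ s ∈ Icc (-R) R := fun t' ht' s hs => by
      have h1 := hR t' ht' ((coe_add_smul_mem_movedPolytope_iff hv.1 y s).2 ⟨hy, hs⟩)
      refine ⟨hM _ h1, ?_⟩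
      have h2 := h1.2
      rwa [inner_coe_add_smul hv.1, abs_le] at h2
    have hint : ∀ t' ∈ Icc (0 : ℝ) 1, IntegrableOn (fun s : ℝ => g ((y : Euc n) + s • v))
        (slab (fun i => inner ℝ (u i) v) (fun i => height v (u i) (b i) (y : Euc n))
          (fun i => velocity P f v (u i) (b i) (y : Euc n)) t') := fun t' ht' =>
      (Continuous.integrableOn_Icc (a := -R) (b := R) (by fun_prop)).mono_set
        fun s hs => (hmem t' ht' s hs).2
    have h0 : (0 : ℝ) ∈ Icc (0 : ℝ) 1 := ⟨le_rfl, zero_le_one⟩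
    rw [integral_indicator_movedPolytope hv.1 y hy, integral_indicator_movedPolytope hv.1 y hy,
      indicator_of_mem (show y ∈ {y : (ℝ ∙ v)ᗮ | (y : Euc n) ∈ proj v '' P} from hy)]
    have := abs_integral_slab_sub_le hC0 (fun i => (hC _ hy i).2) hM0 (hint t ht) (hint 0 h0)
      (fun s hs => (hmem t ht s hs).1) (fun s hs => (hmem 0 h0 s hs).1)
    rwa [abs_of_nonneg ht.1] at this
  · rw [integral_indicator_movedPolytope_of_notMem hv.1 y hy,
      integral_indicator_movedPolytope_of_notMem hv.1 y hy, indicator_of_notMem (show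
        y ∉ {y : (ℝ ∙ v)ᗮ | (y : Euc n) ∈ proj v '' P} from hy)]
    simp

/-- Dominated convergence is applied to the slopes of the fibre integrals: their limits exist for
almost every `y`, and a constant on the compact set `π(P)` dominates them. -/
theorem hasDerivWithinAt_integral_movedPolytope (h : IsIrredundantDescription P u b)
    (hP : IsFullPolytope P)
    (hf : ∀ F ∈ facets P, IsPiecewiseAffineConcaveOn (intrinsicInterior ℝ F) f)
    (hv : IsGeneric u v) {g : Euc n → ℝ} (hg : Continuous g) :
    HasDerivWithinAt (fun t : ℝ => ∫ x in movedPolytope P f u b v t, g x)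
      (∑ i, ∫ x, g x * f x ∂(relVolume (facetOf P (u i) (b i)))) (Icc 0 1) 0 := by
  set G : ℝ → (ℝ ∙ v)ᗮ → ℝ := fun t y =>
    ∫ s : ℝ, (movedPolytope P f u b v t).indicator g ((y : Euc n) + s • v) with hG
  have h0 : (0 : ℝ) ∈ Icc (0 : ℝ) 1 := ⟨le_rfl, zero_le_one⟩
  have hGint : ∀ t ∈ Icc (0 : ℝ) 1, Integrable (G t) := fun t ht =>
    (integrable_indicator_comp_coe_add_smul hv.1
      (isCompact_movedPolytope h hP hf hv ht) hg).integral_prod_left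
  have hFG : ∀ t ∈ Icc (0 : ℝ) 1, ∫ x in movedPolytope P f u b v t, g x = ∫ y, G t y :=
    fun t ht => setIntegral_eq_integral_integral_coe_add_smul hv.1
      (isCompact_movedPolytope h hP hf hv ht) hg
  obtain ⟨B, hB⟩ := exists_bound_integral_indicator_movedPolytope_sub h hP hf hv hg
  have hS := isCompact_preimage_proj_image (v := v) hP
  set S := {y : (ℝ ∙ v)ᗮ | (y : Euc n) ∈ proj v '' P} with hSdef
  have hsum : ∑ i, ∫ x, g x * f x ∂(relVolume (facetOf P (u i) (b i))) =
      ∫ y : (ℝ ∙ v)ᗮ, ∑ i, P.indicator g (lift v (u i) (b i) (y : Euc n)) *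
        velocity P f v (u i) (b i) (y : Euc n) := by
    rw [integral_finsetSum _ fun i _ => integrable_indicator_mul_velocity h hP hf hg i]
    exact Finset.sum_congr rfl fun i _ => (integral_indicator_mul_velocity h hP hf hv g i).symm
  rw [hsum, hasDerivWithinAt_iff_tendsto_slope]
  have hself : ∀ᶠ t : ℝ in 𝓝[Icc 0 1 \ {0}] 0, t ∈ Icc (0 : ℝ) 1 \ {0} := self_mem_nhdsWithin
  have hslope : (fun t => ∫ y, slope (fun r => G r y) 0 t) =ᶠ[𝓝[Icc 0 1 \ {0}] 0]
      slope (fun t : ℝ => ∫ x in movedPolytope P f u b v t, g x) 0 := by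
    filter_upwards [hself] with t ht
    simp only [slope, vsub_eq_sub, smul_eq_mul]
    rw [integral_const_mul, integral_sub (hGint t ht.1) (hGint 0 h0), hFG t ht.1, hFG 0 h0]
  refine Filter.Tendsto.congr' hslope
    (tendsto_integral_filter_of_dominated_convergence (S.indicator fun _ => B) ?_ ?_ ?_ ?_)
  · filter_upwards [hself] with t ht
    simp only [slope, vsub_eq_sub, smul_eq_mul]
    exact (((hGint t ht.1).sub (hGint 0 h0)).const_mul _).aestronglyMeasurable
  · filter_upwards [hself] with t ht
    refine Filter.Eventually.of_forall fun y => ?_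
    have ht0 : 0 < t := lt_of_le_of_ne ht.1.1 fun h => ht.2 h.symm
    rw [slope, vsub_eq_sub, sub_zero, norm_smul, norm_inv, Real.norm_eq_abs,
      Real.norm_eq_abs, abs_of_pos ht0, inv_mul_le_iff₀ ht0, mul_comm]
    exact hB t ht.1 y
  · exact (integrableOn_const hS.measure_lt_top.ne).integrable_indicator hS.measurableSet
  · filter_upwards [h.ae_height_injective hP.2 hv] with y hy
    have hd := (hasDerivAt_integral_indicator_movedPolytope (f := f) h hP hv hg hy).hasDerivWithinAt
      (s := Icc 0 1)
    exact hasDerivWithinAt_iff_tendsto_slope.1 hd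

theorem hasDerivWithinAt_integral_polytopeFamily (h : IsIrredundantDescription P u b)
    (hP : IsFullPolytope P)
    (hf : ∀ F ∈ facets P, IsPiecewiseAffineConcaveOn (intrinsicInterior ℝ F) f)
    (hv : IsGeneric u v) {g : Euc n → ℝ} (hg : Continuous g) :
    HasDerivWithinAt (fun t : ℝ => ∫ x in polytopeFamily P f u b v t, g x)
      (∑ i, ∫ x, g x * f x ∂(relVolume (facetOf P (u i) (b i)))) (Icc 0 1) 0 := by
  refine (hasDerivWithinAt_integral_movedPolytope h hP hf hv hg).congr_of_eventuallyEq ?_ ?_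
  · filter_upwards [(eventually_polytopeFamily_eq h hP hf hv).filter_mono nhdsWithin_le_nhds]
      with t ht
    rw [ht]
  · rw [polytopeFamily_zero h hv, movedPolytope_zero h hv]

end WeakDerivative

/-! ### Integrals against signed measures with density. -/

section SignedDensity

variable {X : Type*} [MeasurableSpace X] {μ : Measure X} {f g : X → ℝ}

theorem integrable_withDensityᵥ (hf : Integrable f μ) (hg : AEStronglyMeasurable g μ)
    (hgf : Integrable (fun x => g x * f x) μ) : (μ.withDensityᵥ f).Integrable g := by
  rw [VectorMeasure.Integrable, Measure.variation_withDensityᵥ hf,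
    integrable_withDensity_iff_integrable_smul₀' hf.aestronglyMeasurable.enorm
      (Filter.Eventually.of_forall fun x => enorm_lt_top)]
  refine hgf.mono ?_ (Filter.Eventually.of_forall fun x => ?_)
  · simp only [toReal_enorm]
    exact hf.aestronglyMeasurable.norm.smul hg
  · simp [mul_comm]

theorem integral_smul_toSignedMeasure {ν : Measure X} [IsFiniteMeasure ν] (g : X → ℝ) :
    ∫ᵛ x, g x ∂•ν.toSignedMeasure = ∫ x, g x ∂ν := by
  -- Over `ℝ` the scalar pairing is symmetric, which reconciles the two argument orders.
  have hflip : ContinuousLinearMap.lsmul ℝ ℝ = (ContinuousLinearMap.lsmul ℝ ℝ (E := ℝ)).flip := by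
    ext
    simp
  rw [hflip]
  exact VectorMeasure.integral_toSignedMeasure

/-- The integral with respect to a signed measure with density. -/
theorem integral_withDensityᵥ (hf : Integrable f μ) (hg : AEStronglyMeasurable g μ)
    (hgf : Integrable (fun x => g x * f x) μ) :
    ∫ᵛ x, g x ∂•(μ.withDensityᵥ f) = ∫ x, g x * f x ∂μ := by
  have := isFiniteMeasure_withDensity_ofReal hf.2
  have := isFiniteMeasure_withDensity_ofReal hf.neg.2
  have hint : ∀ {h : X → ℝ}, Integrable h μ → (∀ x, |h x| ≤ |f x|) →
      Integrable (fun x => (ENNReal.ofReal (h x)).toReal • g x) μ := fun {h} hh hle => by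
    refine hgf.mono (hh.aestronglyMeasurable.aemeasurable.ennreal_ofReal.ennreal_toReal
      |>.aestronglyMeasurable.smul hg) (Filter.Eventually.of_forall fun x => ?_)
    rw [norm_smul, norm_mul, mul_comm]
    refine mul_le_mul_of_nonneg_left ?_ (norm_nonneg _)
    rw [ENNReal.toReal_ofReal', Real.norm_eq_abs, Real.norm_eq_abs, abs_of_nonneg (le_max_right _ _)]
    exact max_le ((le_abs_self _).trans (hle x)) (abs_nonneg _)
  have h1 := hint hf fun x => le_rfl
  have h2 := hint (h := fun x => -f x) hf.neg fun x => (abs_neg _).le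
  have hm1 := hf.aestronglyMeasurable.aemeasurable.ennreal_ofReal
  have hm2 : AEMeasurable (fun x => ENNReal.ofReal (-f x)) μ :=
    hf.neg.aestronglyMeasurable.aemeasurable.ennreal_ofReal
  have hlt : ∀ h : X → ℝ, ∀ᵐ x ∂μ, ENNReal.ofReal (h x) < ⊤ := fun h =>
    Filter.Eventually.of_forall fun x => ENNReal.ofReal_lt_top
  -- Splitting `f` into positive and negative parts reduces the claim to two finite positive
  -- measures.
  rw [withDensityᵥ_eq_withDensity_pos_part_sub_withDensity_neg_part hf,
    VectorMeasure.integral_sub_vectorMeasure, integral_smul_toSignedMeasure,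
    integral_smul_toSignedMeasure, integral_withDensity_eq_integral_toReal_smul₀ hm1 (hlt _),
    integral_withDensity_eq_integral_toReal_smul₀ hm2 (hlt _), ← integral_sub h1 h2]
  · refine integral_congr_ae (Filter.Eventually.of_forall fun x => ?_)
    simp only [ENNReal.toReal_ofReal', smul_eq_mul]
    rw [← sub_mul, mul_comm]
    congr 1
    rcases le_total 0 (f x) with h | h
    · rw [max_eq_left h, max_eq_right (by linarith), sub_zero]
    · rw [max_eq_right h, max_eq_left (by linarith)]
      ring
  · rw [VectorMeasure.Integrable, Measure.variation_toSignedMeasure,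
      integrable_withDensity_iff_integrable_smul₀' hm1 (hlt _)]
    exact h1
  · rw [VectorMeasure.Integrable, Measure.variation_toSignedMeasure,
      integrable_withDensity_iff_integrable_smul₀' hm2 (hlt _)]
    exact h2

end SignedDensity

/-! ### Assembly of the facet measure. -/

section FacetMeasure

variable {n m : ℕ} {P : Set (Euc n)} {f : Euc n → ℝ} {u : Fin m → Euc n} {b : Fin m → ℝ}
  {v : Euc n}

theorem IsIrredundantDescription.exists_isGeneric (h : IsIrredundantDescription P u b)
    (hP : IsFullPolytope P) (hn : n ≠ 0) : ∃ v, IsGeneric u v := by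
  have : NeZero n := ⟨hn⟩
  obtain ⟨w, hw⟩ := exists_ne (0 : Euc n)
  -- Boundedness yields at least one facet normal; without it the vector chosen next could be zero.
  obtain ⟨i, -⟩ := exists_inner_pos_of_isBounded h hP.nonempty hP.isCompact.isBounded hw
  -- Finitely many nonzero functionals have a common point at which none vanishes.
  obtain ⟨v, hv⟩ := Module.Dual.exists_forall_ne_zero_of_forall_exists
    (fun i => innerₗ (Euc n) (u i)) fun i => ⟨u i, by
      simp [h.norm_eq i]⟩
  simp only [innerₗ_apply_apply] at hv
  have hv0 : v ≠ 0 := by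
    rintro rfl
    exact hv i (inner_zero_right _)
  refine ⟨‖v‖⁻¹ • v, norm_smul_inv_norm hv0, fun j => ?_⟩
  rw [inner_smul_right]
  exact mul_ne_zero (inv_ne_zero (norm_ne_zero_iff.2 hv0)) (hv j)

theorem integrable_relVolume_mul (h : IsIrredundantDescription P u b)
    (hP : IsFullPolytope P)
    (hf : ∀ F ∈ facets P, IsPiecewiseAffineConcaveOn (intrinsicInterior ℝ F) f)
    (hv : IsGeneric u v) {g : Euc n → ℝ} (hg : Continuous g) (i : Fin m) :
    Integrable (fun x => g x * f x) (relVolume (facetOf P (u i) (b i))) := by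
  have hF := hP.measurableSet_facetOf (u i) (b i)
  have hc : Continuous fun x => g x * facetExtension P f (u i) (b i) x :=
    hg.mul (continuous_facetExtension h hP.2 hf i)
  have hint : Integrable (fun x => g x * facetExtension P f (u i) (b i) x)
      (relVolume (facetOf P (u i) (b i))) := by
    rw [relVolume_eq_map_lift hv.1 (h.norm_eq i) (hv.2 i) hF (fun x hx => hx.2)
      (h.affDim_facetOf_eq hP.2 hv.1 i)]
    refine Integrable.smul_measure ?_ ENNReal.ofReal_ne_top
    rw [(measurableEmbedding_lift _ _).integrable_map_iff]
    exact (((hc.comp ((continuous_lift _ _).comp continuous_subtype_val)).continuousOn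
      (s := (fun y : (ℝ ∙ v)ᗮ => lift v (u i) (b i) (y : Euc n)) ⁻¹' P)).integrableOn_compact
        (isCompact_preimage_lift hP _ _)).mono_set (preimage_mono fun x hx => hx.1)
  refine hint.congr ?_
  filter_upwards [h.ae_facetExtension_eq hP hf hv i] with x hx
  rw [hx]

theorem integrable_relVolume_facetOf (h : IsIrredundantDescription P u b)
    (hP : IsFullPolytope P)
    (hf : ∀ F ∈ facets P, IsPiecewiseAffineConcaveOn (intrinsicInterior ℝ F) f)
    (hv : IsGeneric u v) (i : Fin m) :
    Integrable f (relVolume (facetOf P (u i) (b i))) := by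
  simpa using integrable_relVolume_mul h hP hf hv (g := fun _ => 1) continuous_const i

theorem facetMeasure_eq_sum (h : IsIrredundantDescription P u b) (hP : IsFullPolytope P)
    (f : Euc n → ℝ) :
    facetMeasure P f = ∑ i, densityMeasure (facetOf P (u i) (b i)) f := by
  rw [facetMeasure, h.facets_eq_range hP.2 hP.convex,
    finsum_mem_range (h.facetOf_injective hP.2), finsum_eq_sum_of_fintype]

theorem isSupportedOn_facetMeasure (h : IsIrredundantDescription P u b)
    (hP : IsFullPolytope P)
    (hf : ∀ F ∈ facets P, IsPiecewiseAffineConcaveOn (intrinsicInterior ℝ F) f)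
    (hv : IsGeneric u v) : IsSupportedOn (facetMeasure P f) (frontier P) := by
  intro B hB hdisj
  rw [facetMeasure_eq_sum h hP, FunLike.coe_sum, Finset.sum_apply]
  refine Finset.sum_eq_zero fun i _ => ?_
  rw [densityMeasure, withDensityᵥ_apply (integrable_relVolume_facetOf h hP hf hv i) hB,
    relVolume, Measure.restrict_restrict hB,
    (hdisj.mono_right (h.facetOf_subset_frontier i)).inter_eq, Measure.restrict_empty,
    integral_zero_measure]

/-- Identifies the integral over the boundary with the integral against the trivially extended
measure. -/
theorem restrict_eq_self_of_isSupportedOn {μ : SignedMeasure (Euc n)} {A : Set (Euc n)}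
    (hA : MeasurableSet A) (hμ : IsSupportedOn μ A) : μ.restrict A = μ := by
  ext B hB
  rw [VectorMeasure.restrict_apply _ hA hB,
    ← VectorMeasure.of_add_of_sdiff (hB.inter hA) hB inter_subset_left,
    sdiff_self_inter,
    hμ (B \ A) (hB.diff hA) disjoint_sdiff_left, add_zero]

theorem integral_facetMeasure (h : IsIrredundantDescription P u b)
    (hP : IsFullPolytope P)
    (hf : ∀ F ∈ facets P, IsPiecewiseAffineConcaveOn (intrinsicInterior ℝ F) f)
    (hv : IsGeneric u v) {g : Euc n → ℝ} (hg : Continuous g) :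
    ∫ᵛ x in frontier P, g x ∂•(facetMeasure P f) =
      ∑ i, ∫ x, g x * f x ∂(relVolume (facetOf P (u i) (b i))) := by
  have hint := fun i => integrable_relVolume_facetOf h hP hf hv i
  have hgf := fun i => integrable_relVolume_mul h hP hf hv hg i
  have hd : ∀ i, (densityMeasure (facetOf P (u i) (b i)) f).Integrable g := fun i =>
    integrable_withDensityᵥ (hint i) hg.aestronglyMeasurable (hgf i)
  rw [restrict_eq_self_of_isSupportedOn isClosed_frontier.measurableSet
    (isSupportedOn_facetMeasure h hP hf hv), facetMeasure_eq_sum h hP,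
    VectorMeasure.integral_finsetSum_vectorMeasure fun i _ => hd i]
  exact Finset.sum_congr rfl fun i _ =>
    integral_withDensityᵥ (hint i) hg.aestronglyMeasurable (hgf i)

theorem realizes_polytopeFamily (h : IsIrredundantDescription P u b)
    (hP : IsFullPolytope P)
    (hf : ∀ F ∈ facets P, IsPiecewiseAffineConcaveOn (intrinsicInterior ℝ F) f)
    (hv : IsGeneric u v) : Realizes (polytopeFamily P f u b v) P (facetMeasure P f) := by
  refine ⟨polytopeFamily_zero h hv, isSupportedOn_facetMeasure h hP hf hv,
    fun t ht => (isFullPolytope_polytopeFamily h hP hf hv ht).isFullConvexBody, fun g hg => ?_⟩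
  exact (hasDerivWithinAt_integral_polytopeFamily h hP hf hv hg).congr_deriv
    (integral_facetMeasure h hP hf hv hg).symm

theorem facets_eq_empty_of_dim_zero (P : Set (Euc 0)) : facets P = ∅ :=
  eq_empty_of_forall_notMem fun _ hF => Nat.succ_ne_zero _ hF.2.2

theorem realizes_const_zero {K : Set (Euc n)} (hK : IsFullConvexBody K) :
    Realizes (fun _ => K) K 0 := by
  refine ⟨rfl, fun B _ _ => rfl, fun _ _ => hK, fun g _ => ?_⟩
  simpa using hasDerivWithinAt_const (0 : ℝ) (Icc 0 1) (∫ x in K, g x)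

end FacetMeasure

end SmallPerturbation

/-! ### The proposition. -/

open SmallPerturbation in
theorem proposition3p2 (n : ℕ) (P : Set (Euc n)) (hP : IsFullPolytope P) (f : Euc n → ℝ)
    (hf_meas : Measurable (fun x : frontier P => f x))
    (hf : ∀ F ∈ facets P, IsPiecewiseAffineConcaveOn (intrinsicInterior ℝ F) f) :
    (facets P).Finite ∧
    (∀ F ∈ facets P, MeasureTheory.Integrable f (relVolume F)) ∧
    facetMeasure P f ∈ smallPerturbations P ∧
    ∀ (m : ℕ) (u : Fin m → Euc n) (b : Fin m → ℝ) (v : Euc n),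
      IsIrredundantDescription P u b → IsGeneric u v →
        (∀ t ∈ Set.Icc (0 : ℝ) 1, IsFullPolytope (polytopeFamily P f u b v t)) ∧
        Realizes (polytopeFamily P f u b v) P (facetMeasure P f) := by
  refine ⟨?_, ?_, ?_, fun m u b v h hv => ⟨fun t ht =>
    isFullPolytope_polytopeFamily h hP hf hv ht, realizes_polytopeFamily h hP hf hv⟩⟩
  · obtain ⟨m, u, b, h⟩ := hP.exists_irredundant
    rw [h.facets_eq_range hP.2 hP.convex]
    exact Set.finite_range _
  · intro F hF
    rcases eq_or_ne n 0 with rfl | hn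
    · simp [facets_eq_empty_of_dim_zero] at hF
    obtain ⟨m, u, b, h⟩ := hP.exists_irredundant
    obtain ⟨v, hv⟩ := h.exists_isGeneric hP hn
    obtain ⟨i, rfl⟩ := h.exists_facetOf_eq hP.2 hP.convex hF
    exact integrable_relVolume_facetOf h hP hf hv i
  -- In dimension zero there are no facets, so the measure is zero and a constant family realizes
  -- it.
  · rcases eq_or_ne n 0 with rfl | hn
    · refine ⟨fun _ => P, ?_⟩
      rw [facetMeasure, facets_eq_empty_of_dim_zero, finsum_mem_empty]
      exact realizes_const_zero hP.isFullConvexBody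
    obtain ⟨m, u, b, h⟩ := hP.exists_irredundant
    obtain ⟨v, hv⟩ := h.exists_isGeneric hP hn
    exact ⟨_, realizes_polytopeFamily h hP hf hv⟩
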